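/- Let $K\subset S^3$ be a knot with a diagram containing $n\ge 1$ parallel, coherently oriented strands in a disc, and let $K_m$ be obtained from $K$ by inserting $m$ positive full twists on these strands. Fix a bridge diagram of $K$ on the oriented sphere $S^2$, with bridges $a_0,\dots,a_T$ ($a_i$ runs from $z_i$ to $w_i$) and overstrands $b_0,\dots,b_T$ (disjoint arcs, where $b_j$ joins $z_j$ to some $w_{\tau(j)}$), such that the disc bounded by a simple closed curve $\gamma$ meets the diagram exactly in the $n$ strands, without crossings, and the strands pass in some left-to-right order through $z_0,\dots,z_{n-1}$ (each strand consisting of an end of $b_i$, the point $z_i$ and the beginning of $a_i$). Applying $m$ negative Dehn twists along $\gamma$ to the overstrands gives a bridge diagram of $K_m$. For $1\le i\le T$ let $\alpha_i$ be the boundary of a tubular neighbourhood of $a_i$, and let $\beta_i$ be the boundary of a tubular neighbourhood of the twisted $b_i$. This defines the multi-pointed Heegaard diagram $\mathcal H_m=(S^2,\{\alpha_i\}_{i=1}^T,\{\beta_i\}_{i=1}^T,\{z_i\}_{i=0}^T,\{w_i\}_{i=0}^T)$ of $K_m$. Let $\mathfrak G(\mathcal H_m)$ be the set of states $\boldsymbol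 x=(x_1,\dots,x_T)$ with $x_i\in\alpha_i\cap\beta_{\sigma(i)}$ for some permutation $\sigma$, and let $\widehat{CFK}(\mathcal H_m)$ be the free $\mathbb F[U_{w_1},\dots,U_{w_T}]$-module on $\mathfrak G(\mathcal H_m)$, where $\mathbb F$ is a field. It is graded by the Maslov grading $M$: $M(\boldsymbol x)-M(\boldsymbol y)=\mu(\phi)-2n_{\boldsymbol w}(\phi)$ for every $\phi\in\pi_2(\boldsymbol x,\boldsymbol y)$, and each $U_{w_i}$ lowers $M$ by $2$. For $1\le j\le n-1$ let $C^j,D^j$ be the two points of $\alpha_j\cap\beta_j$ inside $\gamma$ that are the vertices of the bigon around $z_j$. Let $\mathfrak G^{i}(\mathcal H_m)$ be the set of states with exactly $n-1-i$ components in $\bigcup_{j=1}^{n-1}\{C^j,D^j\}$; thus $\mathfrak G^{n-1}(\mathcal H_m)$ consists of the states using none of these points. Let $B_m=\max_{\boldsymbol x\in\mathfrak G(\mathcal H_m)}M(\boldsymbol x)$ be the highest Maslov grading of a generator, and write $\widehat{CFK}_d(\mathcal H_m)$ for the part of Maslov grading $d$. Then for every $k\in\mathbb N$ there is $m_k$ such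 that for all $m\ge m_k$ and all $0\le j\le k-1$, $$\widehat{CFK}_{B_m-j}(\mathcal H_m)\subset\langle\mathfrak G^{n-1}(\mathcal H_m)\rangle,$$ where $\langle\cdot\rangle$ denotes the $\mathbb F[U_{w_1},\dots,U_{w_T}]$-submodule spanned by a set of generators. -/

import Mathlib

/-- `q` is the successor of `p` in the list `l`, read cyclically. -/
def CycNext {P : Type} (l : List P) (p q : P) : Prop :=
  ∃ k : ℕ, l[k]? = some p ∧ l[(k + 1) % l.length]? = some q

/-! ### Bridge diagrams -/

/-- The combinatorial code of a bridge diagram on the oriented sphere, with bridges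
`a_0, …, a_T` and overstrands `b_0, …, b_T`. The bridge `a_i` runs from `z_i` to `w_i`; the
overstrand `b_j` is traversed from `z_j` to `w_{τ j}` (against the orientation of the knot).
`X` is the set of crossings; `a i` and `b j` list the crossings met along `a_i` and `b_j`, starting
at the `z`-end. `pos x` says that at the crossing `x` the pair
(direction of `a` away from `z`, direction of `b` away from `z`)
is a positively oriented frame of the sphere. -/
structure BridgeDiagram (T : ℕ) (X : Type) where
  a : Fin (T + 1) → List X
  b : Fin (T + 1) → List X
  pos : X → Bool
  τ : Equiv.Perm (Fin (T + 1))

/-- A bridge diagram with a distinguished disc `Δ`, bounded by the curve `γ`, which meets the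
diagram in `n` parallel arcs. The `p`-th arc from the left (seen when looking along the orientation,
which is drawn downwards in the comments below) consists of the last segment of the overstrand
`b_{strand p}`, the point `z_{strand p}` and the first segment of the bridge `a_{strand p}`.
There are no crossings inside `Δ`; so the crossings `X` are those outside `Δ`, and `γ` meets,
counterclockwise, `a_{strand 0}, …, a_{strand (n-1)}, b_{strand (n-1)}, …, b_{strand 0}`. -/
structure StrandDiagram (T n : ℕ) (X : Type) extends BridgeDiagram T X where
  strand : Fin n → Fin (T + 1)

namespace StrandDiagram

variable {T n : ℕ} {X : Type} (D : StrandDiagram T n X)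

/-- The passages of the knot through the marked points and the crossings. -/
inductive Passage (T : ℕ) (X : Type)
  | z (i : Fin (T + 1))
  | w (i : Fin (T + 1))
  | under (x : X)
  | over (x : X)

/-- The closed walk along the oriented knot: from `z_i` along `a_i` to `w_i`, then back along
the overstrand `b_j` ending at `w_i`, that is `j = τ⁻¹ i`, to `z_j`, and so on. -/
def knotWalk : List (Passage T X) :=
  (List.range (T + 1)).flatMap fun r =>
    let i : Fin (T + 1) := (D.τ⁻¹ ^ r) 0
    [Passage.z i] ++ (D.a i).map Passage.under ++ [Passage.w i] ++
      (D.b (D.τ⁻¹ i)).reverse.map Passage.over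

/-- A half-edge of the projection: it leaves a passage forwards (`true`) or backwards (`false`)
along the orientation of the knot. -/
abbrev Dart (T : ℕ) (X : Type) := Passage T X × Bool

/-- The half-edges leaving the disc `Δ`, in counterclockwise order. -/
def discDarts : List (Dart T X) :=
  (List.finRange n).map (fun p => (Passage.z (D.strand p), true)) ++
    (List.finRange n).reverse.map (fun p => (Passage.z (D.strand p), false))

/-- `Turn d e`: the half-edge `e` comes next after `d` in the counterclockwise order around their
common vertex. The vertices are the disc `Δ` (shrunk to a point), the marked points outside
`Δ`, and the crossings. -/
inductive Turn : Dart T X → Dart T X → Prop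
  | disc {d e} : CycNext D.discDarts d e → Turn d e
  | z {d e} (i : Fin (T + 1)) : i ∉ Set.range D.strand →
      CycNext [(Passage.z i, true), (Passage.z i, false)] d e → Turn d e
  | w {d e} (i : Fin (T + 1)) :
      CycNext [(Passage.w i, true), (Passage.w i, false)] d e → Turn d e
  | crossPos {d e} (x : X) : D.pos x = true →
      CycNext [(Passage.under x, true), (Passage.over x, false),
        (Passage.under x, false), (Passage.over x, true)] d e → Turn d e
  | crossNeg {d e} (x : X) : D.pos x = false →
      CycNext [(Passage.under x, true), (Passage.over x, true),
        (Passage.under x, false), (Passage.over x, false)] d e → Turn d e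

/-- Consecutive half-edges along the boundary of a complementary region. -/
inductive FaceStep : Dart T X → Dart T X → Prop
  | fwd {q q' e} : CycNext D.knotWalk q q' → D.Turn (q', false) e → FaceStep (q, true) e
  | bwd {q q' e} : CycNext D.knotWalk q q' → D.Turn (q, true) e → FaceStep (q', false) e

/-- The code describes a bridge diagram, on the sphere, of a knot with `n ≥ 1` parallel strands
through the points `z_0, …, z_{n-1}`. The last condition is that the Euler characteristic is two:
with `Δ` shrunk to a point there are `|X| + (T + 1 - n) + (T + 1) + 1` vertices and
`2|X| + 2(T + 1)` edges. -/
structure IsValid [Fintype X] [DecidableEq X] : Prop where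
  a_once : ∀ x, ((List.finRange (T + 1)).flatMap D.a).count x = 1
  b_once : ∀ x, ((List.finRange (T + 1)).flatMap D.b).count x = 1
  knot : ∀ i j, D.τ.SameCycle i j
  n_pos : 0 < n
  strand_injective : Function.Injective D.strand
  range_strand : ∀ i, i ∈ Set.range D.strand ↔ (i : ℕ) < n
  planar : Nat.card (Quot D.FaceStep) = Fintype.card X + n + 1

/-- The bridge diagram of `K_m`, obtained by applying `m` negative (left-turning) Dehn twists
along `γ` to the overstrands. Coming from outside, each of the `n` overstrands winds `m` times
clockwise around the centre of `Δ`, in a collar of `γ`, and in every turn crosses all the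
bridges `a_{strand p}` once. The crossing `(k, p, q)` is the one of `a_{strand p}` with
`b_{strand q}` in the `k`-th turn, counted from the outside. Away from the `z`-end, one
passes the turns from the last one to the first one; in each turn, a bridge meets the overstrands
from left to right, and an overstrand meets the bridges from left to right. -/
def twist (m : ℕ) : BridgeDiagram T (X ⊕ (Fin m × Fin n × Fin n)) where
  a i := ((List.finRange m).reverse.flatMap fun k =>
      ((List.finRange n).filter fun p => D.strand p = i).flatMap fun p =>
        (List.finRange n).map fun q => Sum.inr (k, p, q)) ++ (D.a i).map Sum.inl
  b j := ((List.finRange m).reverse.flatMap fun k =>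
      ((List.finRange n).filter fun q => D.strand q = j).flatMap fun q =>
        (List.finRange n).map fun p => Sum.inr (k, p, q)) ++ (D.b j).map Sum.inl
  pos := Sum.elim D.pos fun _ => true
  τ := D.τ

end StrandDiagram

/-! ### Multi-pointed Heegaard diagrams on the sphere -/

/-- A corner: a point together with one of the four quadrants there. The first Boolean says
whether the quadrant lies to the left of the `α`-curve, the second one whether it lies to the left
of the `β`-curve. -/
abbrev Corner (P : Type) := P × Bool × Bool

/-- A combinatorial multi-pointed Heegaard diagram `(S², α_1, …, α_T, β_1, …, β_T, z, w)`.
`P` is the set of points, `α i` and `β j` list the points on the oriented curves `α_i` and `β_j`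
in cyclic order, and `pos p` says that (direction of `α`, direction of `β`) is a positively
oriented frame at `p`. The base points are given by corners of the regions that contain them.

The curves `α_0` and `β_0` are not part of the Heegaard diagram. They are only drawn
in order to cut the regions of the diagram into polygons: they carry no component of a generator
and no part of the boundary of a domain. -/
structure HeegaardDiagram (T : ℕ) (P : Type) where
  α : Fin (T + 1) → List P
  β : Fin (T + 1) → List P
  pos : P → Bool
  z : Fin (T + 1) → Corner P
  w : Fin (T + 1) → Corner P

namespace HeegaardDiagram

variable {T : ℕ} {P : Type} (H : HeegaardDiagram T P)

/-- Corners that are joined along one side (left or right) of an edge of a curve. With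
`pos p = true`, the curve `α` leaves `p` on the right of `β`, and `β` leaves `p` on the left
of `α`. -/
inductive Adj : Corner P → Corner P → Prop
  | alpha (i : Fin (T + 1)) (p q : P) (s : Bool) : CycNext (H.α i) p q →
      Adj (p, s, !H.pos p) (q, s, H.pos q)
  | beta (j : Fin (T + 1)) (p q : P) (t : Bool) : CycNext (H.β j) p q →
      Adj (p, H.pos p, t) (q, !H.pos q, t)

/-- The polygons into which the sphere is cut by all the curves. -/
def Face : Type := Quot H.Adj

/-- The polygon containing a given corner. -/
def face (c : Corner P) : H.Face := Quot.mk _ c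

/-- `x = (x_1, …, x_T)` is a Heegaard state: `x_i ∈ α_i ∩ β_{σ(i)}` for a permutation `σ`. -/
def IsState (x : Fin T → P) : Prop :=
  ∃ σ : Equiv.Perm (Fin T), ∀ i, x i ∈ H.α i.succ ∧ x i ∈ H.β (σ i).succ

/-- The generators, that is, the points of `𝕋_α ∩ 𝕋_β`. -/
abbrev State : Type := {x : Fin T → P // H.IsState x}

open Classical in
/-- The multiplicity of the point `p` in the state `x`. -/
noncomputable def State.ind {H : HeegaardDiagram T P} (x : H.State) (p : P) : ℤ :=
  if p ∈ Set.range x.1 then 1 else 0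

/-- The domain `D(φ)` of a Whitney disk `φ ∈ π₂(x, y)`: a 2-chain with `∂(∂D ∩ α) = y - x` whose
boundary lies on `α_1, …, α_T, β_1, …, β_T`. The multiplicity of `∂D` on an oriented edge is
the multiplicity on its left minus the one on its right; the equation in `boundary` is
(edge of `α` entering `p`) - (edge of `α` leaving `p`) = `y - x`, which implies the
corresponding equation `∂(∂D ∩ β) = x - y` for `β`. -/
structure Domain (x y : H.State) where
  mult : H.Face → ℤ
  boundary : ∀ p,
    (mult (H.face (p, true, H.pos p)) - mult (H.face (p, false, H.pos p))) -
      (mult (H.face (p, true, !H.pos p)) - mult (H.face (p, false, !H.pos p))) =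
    y.ind p - x.ind p
  not_alpha_zero : ∀ p ∈ H.α 0, ∀ t, mult (H.face (p, true, t)) = mult (H.face (p, false, t))
  not_beta_zero : ∀ p ∈ H.β 0, ∀ s, mult (H.face (p, s, true)) = mult (H.face (p, s, false))

namespace Domain

variable {H} {x y : H.State} (φ : H.Domain x y)

/-- The Euler measure `e(D)`: a polygon with `c` right-angled corners has Euler measure
`1 - c / 4`. As the Euler measure is additive under cutting along curves meeting the others
transversally, the auxiliary curves do not affect it. -/
noncomputable def eulerMeasure : ℚ :=
  ∑ᶠ f : H.Face, (φ.mult f : ℚ) * (1 - (Nat.card {c : Corner P // H.face c = f} : ℚ) / 4)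

/-- The point measure: the average of the multiplicities in the four quadrants at `p`. -/
noncomputable def pointMeasure (p : P) : ℚ :=
  (∑ s : Bool, ∑ t : Bool, (φ.mult (H.face (p, s, t)) : ℚ)) / 4

/-- The Maslov index `μ(φ) = e(D) + n_x(D) + n_y(D)` (Lipshitz's formula). -/
noncomputable def maslovIndex : ℚ :=
  φ.eulerMeasure + ∑ i, φ.pointMeasure (x.1 i) + ∑ i, φ.pointMeasure (y.1 i)

/-- `n_w(φ)`, the total multiplicity at the base points `w_0, …, w_T`. -/
def nw : ℤ := ∑ i, φ.mult (H.face (H.w i))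

end Domain

/-- `M` is a Maslov grading of the generators: `M(x) - M(y) = μ(φ) - 2 n_w(φ)` for every Whitney
disk `φ ∈ π₂(x, y)`. This determines `M` up to an additive constant. -/
def IsMaslovGrading (M : H.State → ℤ) : Prop :=
  ∀ (x y : H.State) (φ : H.Domain x y), ((M x - M y : ℤ) : ℚ) = φ.maslovIndex - 2 * (φ.nw : ℚ)

/-- The chain module of the knot Floer complex: the free module over `F[U_{w_1}, …, U_{w_T}]` on
the generators. -/
abbrev CFK (F : Type*) [Field F] : Type _ := H.State →₀ MvPolynomial (Fin T) F

/-- The part of Maslov grading `d`. Multiplication by any variable lowers the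
grading by two. -/
noncomputable def CFKgr (F : Type*) [Field F] (M : H.State → ℤ) (d : ℤ) :
    Submodule F (H.CFK F) :=
  Submodule.span F {f | ∃ (x : H.State) (e : Fin T →₀ ℕ), M x - 2 * (e.degree : ℤ) = d ∧
    f = Finsupp.single x (MvPolynomial.monomial e 1)}

/-- `⟨S⟩`: the submodule over `F[U_{w_1}, …, U_{w_T}]` spanned by a family of generators. -/
noncomputable def spanned (F : Type*) [Field F] (S : Set H.State) :
    Submodule (MvPolynomial (Fin T) F) (H.CFK F) :=
  Submodule.span _ ((fun x => Finsupp.single x 1) '' S)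

end HeegaardDiagram

/-! ### From bridge diagrams to Heegaard diagrams -/

/-- The points of the Heegaard diagram of a bridge diagram with crossing set `X`. A Boolean `true`
(`false`) stands for the left (right) side of an arc directed away from its `z`-end.
`cross x s t`: at a crossing `x` of `a_i` and `b_j`, the intersection of the `s`-side of `α_i` with
the `t`-side of `β_j`. `zEnd i s`, `wEnd i s`: near `z_i` (`w_i`), where `α_i` meets the
`β`-curve around the same point twice, the intersection on the `s`-side of `a_i`. -/
inductive BridgePoint (T : ℕ) (X : Type)
  | cross (x : X) (s t : Bool)
  | zEnd (i : Fin (T + 1)) (s : Bool)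
  | wEnd (i : Fin (T + 1)) (s : Bool)

namespace BridgeDiagram

open BridgePoint

variable {T : ℕ} {X : Type} (D : BridgeDiagram T X)

/-- The two points near the crossing `x` on the `s`-side of the bridge, directed away from `z`. -/
def alphaSide (s : Bool) (x : X) : List (BridgePoint T X) :=
  if D.pos x then [cross x s true, cross x s false] else [cross x s false, cross x s true]

/-- The two points near the crossing `x` on the `t`-side of the overstrand, directed away
from `z`. -/
def betaSide (t : Bool) (x : X) : List (BridgePoint T X) :=
  if D.pos x then [cross x false t, cross x true t] else [cross x true t, cross x false t]

/-- The Heegaard diagram of a bridge diagram: `α_i` is the boundary of a tubular neighbourhood of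
`a_i` and `β_j` the boundary of a tubular neighbourhood of `b_j`, oriented counterclockwise, i.e.
with the arc on the left: along the right side of the arc away from `z`, around its other end, back
along the left side, and around `z`. Each base point lies in a bigon, to the left of both curves. -/
def heegaard : HeegaardDiagram T (BridgePoint T X) where
  α i := (D.a i).flatMap (D.alphaSide false) ++ [wEnd i false, wEnd i true] ++
    ((D.a i).flatMap (D.alphaSide true)).reverse ++ [zEnd i true, zEnd i false]
  β j := (D.b j).flatMap (D.betaSide false) ++ [wEnd (D.τ j) true, wEnd (D.τ j) false] ++
    ((D.b j).flatMap (D.betaSide true)).reverse ++ [zEnd j false, zEnd j true]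
  pos
    | cross x s t => D.pos x == (s == t)
    | zEnd _ s => !s
    | wEnd _ s => s
  z i := (zEnd i false, true, true)
  w i := (wEnd i false, true, true)

end BridgeDiagram

namespace StrandDiagram

variable {T n : ℕ} {X : Type} (D : StrandDiagram T n X)

/-- The Heegaard diagram `H_m` of `K_m`. -/
def heegaard (m : ℕ) :
    HeegaardDiagram T (BridgePoint T (X ⊕ (Fin m × Fin n × Fin n))) :=
  (D.twist m).heegaard

/-- The points `C^j, D^j` for `1 ≤ j ≤ n - 1`: the two points of `α_j ∩ β_j` inside the disc bounded
by `γ`, which are the vertices of the bigon around `z_j`. -/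
def innerPoints (T n : ℕ) (Y : Type) : Set (BridgePoint T Y) :=
  {p | ∃ (j : Fin (T + 1)) (s : Bool), 1 ≤ (j : ℕ) ∧ (j : ℕ) < n ∧ p = BridgePoint.zEnd j s}

/-- The family `𝔊^i(H_m)` of the states with exactly `n - 1 - i` components among the points
`C^j, D^j`. -/
def family (m i : ℕ) : Set (D.heegaard m).State :=
  {x | {l : Fin T | x.1 l ∈ innerPoints T n _}.ncard + i + 1 = n}

end StrandDiagram

/-! Suppose a state x uses an inner point, on side `s` of strand `j`. This point lies only on the α-
and β-curve of that strand, so it can be pushed outwards along both curves to a crossing of the same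
two bands in the second outermost turn. This gives a state y. The two arcs travelled, a radial one
on α and a winding one on β, close up to a loop around the centre of the disc. Its winding number is
a nonnegative 2-chain, roughly a stack of d = m - 2 discs, so its Euler measure is at least d. The
chain misses every w and its point measures are nonnegative, hence Lipshitz's formula gives M(y) -
M(x) ≥ d. For m ≥ k + 2 such an x lies at least k below the top grading, and its multiples by the
variables lie lower still.

To make this precise, cells of the twist region get polar coordinates (b, a): the row b counts from
the centre, a is angular, odd indices lie inside a band and even ones between bands. As the
overstrands spiral, (b, 2n) and (b + 2n, 0) are the same cell. `cornerCell_eq_of_adj` shows that the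
coordinates descend to faces, `euler_bound` is the Euler estimate, `spiralDomain` is the negated
chain, and `exists_maslov_add_le` compares the gradings. -/

/-! ### Cyclic lists as closed paths. -/

/-- The list `l` is a path from `u` to `v`, where passing the point `p` leads from `i p`
to `o p`. -/
def IsPath {P S : Type*} (i o : P → S) : List P → S → S → Prop
  | [], u, v => u = v
  | p :: l, u, v => i p = u ∧ IsPath i o l (o p) v

namespace IsPath

variable {P S : Type*} {i o : P → S}

theorem append {l₁ l₂ : List P} {u v w : S} (h₁ : IsPath i o l₁ u v) (h₂ : IsPath i o l₂ v w) :
    IsPath i o (l₁ ++ l₂) u w := by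
  induction l₁ generalizing u with
  | nil => cases h₁; exact h₂
  | cons p l ih => exact ⟨h₁.1, ih h₁.2⟩

theorem reverse {l : List P} {u v : S} (h : IsPath i o l u v) : IsPath o i l.reverse v u := by
  induction l generalizing u with
  | nil => cases h; rfl
  | cons p l ih =>
    rw [List.reverse_cons]
    exact (ih h.2).append ⟨rfl, h.1⟩

theorem of_const {l : List P} {u : S} (h : ∀ p ∈ l, i p = u ∧ o p = u) : IsPath i o l u u := by
  induction l with
  | nil => rfl
  | cons p l ih =>
    refine ⟨(h p (by simp)).1, ?_⟩
    rw [(h p (by simp)).2]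
    exact ih fun q hq => h q (by simp [hq])

/-- `U` records the value between consecutive blocks; the blocks will be the turns, or the bands
crossed in one turn. -/
theorem flatMap_finRange {n : ℕ} {g : Fin n → List P} {U : ℕ → S}
    (h : ∀ q : Fin n, IsPath i o (g q) (U q) (U (q + 1))) :
    IsPath i o ((List.finRange n).flatMap g) (U 0) (U n) := by
  induction n generalizing U with
  | zero => simp [IsPath]
  | succ n ih =>
    rw [List.finRange_succ, List.flatMap_cons, List.flatMap_map]
    refine (h 0).append ?_
    have := ih (g := fun q => g q.succ) (U := fun k => U (k + 1)) fun q => by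
      simpa using h q.succ
    simpa using this

theorem flatMap_finRange_reverse {n : ℕ} {g : Fin n → List P} {U : ℕ → S}
    (h : ∀ q : Fin n, IsPath i o (g q) (U (q + 1)) (U q)) :
    IsPath i o ((List.finRange n).reverse.flatMap g) (U n) (U 0) := by
  induction n generalizing U with
  | zero => simp [IsPath]
  | succ n ih =>
    rw [List.finRange_succ, List.reverse_cons, List.flatMap_append, ← List.map_reverse,
      List.flatMap_map]
    have := ih (g := fun q => g q.succ) (U := fun k => U (k + 1)) fun q => by
      simpa using h q.succ
    refine append this ?_
    simpa using h 0

theorem out_eq_in {l : List P} {u v : S} (h : IsPath i o l u v) {k : ℕ} {p q : P}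
    (hp : l[k]? = some p) (hq : l[k + 1]? = some q) : o p = i q := by
  induction l generalizing u k with
  | nil => simp at hp
  | cons a l ih =>
    cases k with
    | zero =>
      cases l with
      | nil => simp at hq
      | cons b l =>
        simp only [List.getElem?_cons_zero, Option.some.injEq, zero_add,
          List.getElem?_cons_succ] at hp hq
        subst hp hq
        exact h.2.1.symm
    | succ k => exact ih h.2 (by simpa using hp) (by simpa using hq)

theorem out_last {l : List P} {u v : S} (h : IsPath i o l u v) {k : ℕ} {p : P}
    (hp : l[k]? = some p) (hk : k + 1 = l.length) : o p = v := by
  induction l generalizing u k with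
  | nil => simp at hp
  | cons a l ih =>
    cases k with
    | zero =>
      have hl : l = [] := by simpa using hk.symm
      subst hl
      obtain rfl : a = p := by simpa using hp
      exact h.2
    | succ k => exact ih h.2 (by simpa using hp) (by simpa using hk)

theorem in_head {l : List P} {u v : S} (h : IsPath i o l u v) {p : P}
    (hp : l[0]? = some p) : i p = u := by
  cases l with
  | nil => simp at hp
  | cons a l =>
    obtain rfl : a = p := by simpa using hp
    exact h.1

end IsPath

/-- Closedness of the path takes care of the pair that wraps around, so the values agree along every
edge of a closed curve. -/
theorem CycNext.out_eq_in {P : Type} {S : Type*} {i o : P → S} {l : List P} {p q : P}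
    (h : CycNext l p q) {u : S} (hl : IsPath i o l u u) : o p = i q := by
  obtain ⟨k, hp, hq⟩ := h
  have hk : k < l.length := (List.getElem?_eq_some_iff.1 hp).1
  rcases Nat.lt_or_ge (k + 1) l.length with h1 | h1
  · rw [Nat.mod_eq_of_lt h1] at hq
    exact hl.out_eq_in hp hq
  · have h2 : k + 1 = l.length := by omega
    rw [h2, Nat.mod_self] at hq
    rw [hl.out_last hp h2, hl.in_head hq]

namespace BridgeDiagram

open BridgePoint

theorem mem_alphaSide {T : ℕ} {X : Type} {D : BridgeDiagram T X} {s : Bool} {x : X}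
    {P : BridgePoint T X} : P ∈ D.alphaSide s x ↔ ∃ t, P = cross x s t := by
  unfold alphaSide
  split_ifs <;> simp [or_comm]

theorem mem_betaSide {T : ℕ} {X : Type} {D : BridgeDiagram T X} {t : Bool} {x : X}
    {P : BridgePoint T X} : P ∈ D.betaSide t x ↔ ∃ s, P = cross x s t := by
  unfold betaSide
  split_ifs <;> simp [or_comm]

end BridgeDiagram

namespace StrandDiagram

open BridgePoint

/-! ### The cells of the twist region -/

/-- The cell next to the `s`-side of the `p`-th band, inside the band for `e = true`. -/
def sideCell (p : ℕ) (s e : Bool) : ℕ := 2 * p + s.toNat + (xor s e).toNat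

/-- The normal form of the cell with radial coordinate `b` and angular coordinate `a`. Cells near
the outer boundary of the twist region are not distinguished. -/
def gridCell (m n b a : ℕ) : Option (ℕ × ℕ × Bool) :=
  -- Angular coordinate 0 is removed where possible: beyond the first turn it is the end of the
  -- preceding turn, and at the centre a gap between bands (even index) is one cell seen from
  -- bridges and overstrands alike. The start of an overstrand band (odd index) stays a cell of its
  -- own.
  let c : ℕ × ℕ := if a = 0 then
    (if 2 * n ≤ b then (b - 2 * n, 2 * n) else if b % 2 = 0 then (0, b) else (b, 0)) else (b, a)
  -- Rows of the outermost turn may belong to regions reaching outside, so they are merged with the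
  -- exterior.
  if c.1 < 2 * n * (m - 1) then some (c.1, c.2, false) else none

theorem gridCell_wrap {m n : ℕ} (hn : 0 < n) (b : ℕ) :
    gridCell m n b (2 * n) = gridCell m n (b + 2 * n) 0 := by
  simp [gridCell, hn.ne']

theorem gridCell_swap {m n a : ℕ} (ha : a ≤ 2 * n) (h2 : a % 2 = 0) :
    gridCell m n 0 a = gridCell m n a 0 := by
  rcases Nat.eq_zero_or_pos a with rfl | h0
  · rfl
  · rcases ha.eq_or_lt with rfl | h
    · simp [gridCell, h0.ne']
    · simp [gridCell, h0.ne', h2, h.not_ge]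

theorem gridCell_outer {m n b a : ℕ} (hm : 0 < m) (hb : 2 * n * m ≤ b) :
    gridCell m n b a = none := by
  obtain ⟨m, rfl⟩ : ∃ m', m = m' + 1 := ⟨m - 1, by omega⟩
  rw [Nat.mul_succ] at hb
  rw [gridCell, Nat.add_sub_cancel, if_neg]
  generalize 2 * n * m = N at *
  split_ifs <;> dsimp only <;> omega

variable {T n : ℕ} {X : Type} (D : StrandDiagram T n X)

/-- The cell of a corner at a point near the end `z` of the `p`-th strand. -/
def endCell (m n p : ℕ) (s e f : Bool) : Option (ℕ × ℕ × Bool) :=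
  match e, f with
  -- The flag separates the bigon around z from the start of the bridge band, which has the same
  -- coordinates.
  | true, true => some (0, 2 * p + 1, true)
  | true, false => gridCell m n 0 (2 * p + 1)
  | false, true => gridCell m n (2 * p + 1) 0
  | false, false => gridCell m n 0 (sideCell p s false)

/-- The number of an overstrand passage in the twist region, counted from the centre. -/
def level {m n : ℕ} (k : Fin m) (q : Fin n) : ℕ := (m - 1 - k) * n + q

open Classical in
/-- The cell of the twist region containing a corner, or `none` outside the twist region. -/
noncomputable def cornerCell (m : ℕ) :
    Corner (BridgePoint T (X ⊕ (Fin m × Fin n × Fin n))) → Option (ℕ × ℕ × Bool)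
  | (cross (Sum.inl _) _ _, _, _) => none
  | (cross (Sum.inr (k, p, q)) s t, e, f) =>
      gridCell m n (sideCell (level k q) (!t) f) (sideCell p s e)
  | (zEnd i s, e, f) =>
      (Function.partialInv D.strand i).elim none fun p => endCell m n p s e f
  | (wEnd _ _, _, _) => none

variable {D}

theorem cornerCell_zEnd (hs : Function.Injective D.strand) (m : ℕ) (p : Fin n) (s e f : Bool) :
    D.cornerCell m (zEnd (D.strand p) s, e, f) = endCell m n p s e f := by
  simp [cornerCell, Function.partialInv_left hs]

theorem cornerCell_zEnd_of_notMem (m : ℕ) {i : Fin (T + 1)} (hi : i ∉ Set.range D.strand)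
    (s e f : Bool) : D.cornerCell m (zEnd i s, e, f) = none := by
  have : Function.partialInv D.strand i = none := by
    unfold Function.partialInv
    rw [dif_neg]
    rintro ⟨p, hp⟩
    exact hi ⟨p, hp⟩
  simp [cornerCell, this]

/-! ### Following the cells along the curves. -/

theorem filter_strand (hs : Function.Injective D.strand) (p : Fin n) :
    ((List.finRange n).filter fun p' => D.strand p' = D.strand p) = [p] := by
  have : (fun p' : Fin n => decide (D.strand p' = D.strand p)) = fun p' => p' == p := by
    funext p'
    by_cases h : p' = p
    · simp [h]
    · simp [h, hs.eq_iff]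
  rw [this, List.filter_beq]
  simp [List.count_eq_one_of_mem (List.nodup_finRange n) (List.mem_finRange p)]

theorem filter_strand_of_notMem {i : Fin (T + 1)} (hi : i ∉ Set.range D.strand) :
    ((List.finRange n).filter fun p => D.strand p = i) = [] := by
  rw [List.filter_eq_nil_iff]
  intro p _ h
  exact hi ⟨p, by simpa using h⟩

theorem level_succ_sub {m n : ℕ} (k : Fin m) (q : Fin n) :
    level k q + n = (m - k) * n + q := by
  have : m - k = (m - 1 - k) + 1 := by omega
  rw [level, this, Nat.add_one_mul]
  ring

/-- Values are functions of the side `e`, so the cells on both sides of an edge are followed at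
once. The test against `!s` exchanges incoming and outgoing corners for `s = true`: both sides are
walked away from z here, while the α-curve runs back along the left one. -/
theorem isPath_alpha_strand (hs : Function.Injective D.strand) {m : ℕ} (hm : 0 < m) (p : Fin n)
    (s : Bool) :
    IsPath (fun P e => D.cornerCell m (P, e, (D.heegaard m).pos P == !s))
      (fun P e => D.cornerCell m (P, e, !((D.heegaard m).pos P == !s)))
      (((D.twist m).a (D.strand p)).flatMap ((D.twist m).alphaSide s))
      (fun e => gridCell m n 0 (sideCell p s e)) (fun _ => none) := by
  have hn : 0 < n := p.pos
  simp only [twist, filter_strand hs, List.flatMap_append, List.flatMap_assoc, List.flatMap_map,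
    List.flatMap_cons, List.flatMap_nil, List.append_nil]
  refine IsPath.append (v := fun _ => none) ?_ (IsPath.of_const ?_)
  · have key := IsPath.flatMap_finRange_reverse (n := m)
      (i := fun P e => D.cornerCell m (P, e, (D.heegaard m).pos P == !s))
      (o := fun P e => D.cornerCell m (P, e, !((D.heegaard m).pos P == !s)))
      (g := fun k => (List.finRange n).flatMap fun q =>
        (D.twist m).alphaSide s (Sum.inr (k, p, q)))
      -- Turn m - 1 is the innermost one, and each turn outwards raises the row by 2n.
      (U := fun k e => gridCell m n (2 * ((m - k) * n)) (sideCell p s e)) ?_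
    · convert key using 2
      · rfl
      · rw [Nat.sub_self, zero_mul, mul_zero]
      · rw [gridCell_outer hm]
        rw [Nat.sub_zero, mul_assoc, mul_comm n m]
    · intro k
      have key := IsPath.flatMap_finRange (n := n)
        (i := fun P e => D.cornerCell m (P, e, (D.heegaard m).pos P == !s))
        (o := fun P e => D.cornerCell m (P, e, !((D.heegaard m).pos P == !s)))
        (g := fun q => (D.twist m).alphaSide s (Sum.inr (k, p, q)))
        (U := fun q e => gridCell m n (2 * ((m - 1 - k) * n + q)) (sideCell p s e)) ?_
      · convert key using 2
        · rw [add_zero, Nat.sub_right_comm, Nat.sub_sub]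
        · congr 2
          have : m - k = (m - 1 - k) + 1 := by omega
          rw [this, Nat.add_one_mul]
      · intro q
        cases s <;>
        simp [IsPath, BridgeDiagram.alphaSide, StrandDiagram.heegaard, BridgeDiagram.heegaard,
          cornerCell, twist, level, sideCell, mul_add, add_assoc]
  · intro P hP
    obtain ⟨x, -, hx⟩ := List.mem_flatMap.1 hP
    have : ∃ s t, P = cross (Sum.inl x) s t := by
      obtain ⟨t, rfl⟩ := BridgeDiagram.mem_alphaSide.1 hx
      exact ⟨_, _, rfl⟩
    obtain ⟨s, t, rfl⟩ := this
    exact ⟨rfl, rfl⟩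

/-- During a turn an overstrand keeps its row while the angle runs from 0 to 2n; `gridCell_wrap`
then moves it n levels outwards. The side enters as `!t` because, directed away from z, the
overstrand winds counterclockwise with the centre on its left. -/
theorem isPath_beta_strand (hs : Function.Injective D.strand) {m : ℕ} (hm : 0 < m) (q : Fin n)
    (t : Bool) :
    IsPath (fun P f => D.cornerCell m (P, !((D.heegaard m).pos P == !t), f))
      (fun P f => D.cornerCell m (P, (D.heegaard m).pos P == !t, f))
      (((D.twist m).b (D.strand q)).flatMap ((D.twist m).betaSide t))
      (fun f => gridCell m n (sideCell q (!t) f) 0) (fun _ => none) := by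
  have hn : 0 < n := q.pos
  simp only [twist, filter_strand hs, List.flatMap_append, List.flatMap_assoc, List.flatMap_map,
    List.flatMap_cons, List.flatMap_nil, List.append_nil]
  refine IsPath.append (v := fun _ => none) ?_ (IsPath.of_const ?_)
  · have key := IsPath.flatMap_finRange_reverse (n := m)
      (i := fun P f => D.cornerCell m (P, !((D.heegaard m).pos P == !t), f))
      (o := fun P f => D.cornerCell m (P, (D.heegaard m).pos P == !t, f))
      (g := fun k => (List.finRange n).flatMap fun p =>
        (D.twist m).betaSide t (Sum.inr (k, p, q)))
      (U := fun k f => gridCell m n (sideCell ((m - k) * n + q) (!t) f) 0) ?_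
    · convert key using 2
      · rfl
      · rw [Nat.sub_self, zero_mul, zero_add]
      · rw [gridCell_outer hm]
        rw [Nat.sub_zero, mul_assoc, mul_comm n m, sideCell]
        omega
    · intro k
      have key := IsPath.flatMap_finRange (n := n)
        (i := fun P f => D.cornerCell m (P, !((D.heegaard m).pos P == !t), f))
        (o := fun P f => D.cornerCell m (P, (D.heegaard m).pos P == !t, f))
        (g := fun p => (D.twist m).betaSide t (Sum.inr (k, p, q)))
        (U := fun p f => gridCell m n (sideCell (level k q) (!t) f) (2 * p)) ?_
      · convert key using 2
        · rw [level, mul_zero, Nat.sub_right_comm, Nat.sub_sub]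
        · rw [gridCell_wrap hn, ← level_succ_sub]
          congr 1
          unfold sideCell
          omega
      · intro p
        cases t <;>
        simp [IsPath, BridgeDiagram.betaSide, StrandDiagram.heegaard, BridgeDiagram.heegaard,
          cornerCell, twist, sideCell, mul_add, add_assoc]
  · intro P hP
    obtain ⟨x, -, hx⟩ := List.mem_flatMap.1 hP
    have : ∃ s t, P = cross (Sum.inl x) s t := by
      obtain ⟨s, rfl⟩ := BridgeDiagram.mem_betaSide.1 hx
      exact ⟨_, _, rfl⟩
    obtain ⟨s, t, rfl⟩ := this
    exact ⟨rfl, rfl⟩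

theorem eq_cross_inl_of_mem_alphaSide {m : ℕ} {i : Fin (T + 1)} (hi : i ∉ Set.range D.strand)
    {s : Bool} {P : BridgePoint T (X ⊕ (Fin m × Fin n × Fin n))}
    (h : P ∈ ((D.twist m).a i).flatMap ((D.twist m).alphaSide s)) :
    ∃ x s t, P = cross (Sum.inl x) s t := by
  obtain ⟨x, hx, h⟩ := List.mem_flatMap.1 h
  simp only [twist, filter_strand_of_notMem hi, List.flatMap_nil, List.mem_append,
    List.mem_flatMap, List.not_mem_nil, and_false, exists_false, false_or, List.mem_map] at hx
  obtain ⟨y, -, rfl⟩ := hx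
  obtain ⟨t, rfl⟩ := BridgeDiagram.mem_alphaSide.1 h
  exact ⟨_, _, _, rfl⟩

theorem eq_cross_inl_of_mem_betaSide {m : ℕ} {j : Fin (T + 1)} (hj : j ∉ Set.range D.strand)
    {t : Bool} {P : BridgePoint T (X ⊕ (Fin m × Fin n × Fin n))}
    (h : P ∈ ((D.twist m).b j).flatMap ((D.twist m).betaSide t)) :
    ∃ x s t, P = cross (Sum.inl x) s t := by
  obtain ⟨x, hx, h⟩ := List.mem_flatMap.1 h
  simp only [twist, filter_strand_of_notMem hj, List.flatMap_nil, List.mem_append,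
    List.mem_flatMap, List.not_mem_nil, and_false, exists_false, false_or, List.mem_map] at hx
  obtain ⟨y, -, rfl⟩ := hx
  obtain ⟨s, rfl⟩ := BridgeDiagram.mem_betaSide.1 h
  exact ⟨_, _, _, rfl⟩

theorem isPath_alpha (hs : Function.Injective D.strand) {m : ℕ} (hm : 0 < m) (i : Fin (T + 1)) :
    ∃ u, IsPath (fun P e => D.cornerCell m (P, e, (D.heegaard m).pos P))
      (fun P e => D.cornerCell m (P, e, !(D.heegaard m).pos P)) ((D.heegaard m).α i) u u := by
  by_cases hi : i ∈ Set.range D.strand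
  · obtain ⟨p, rfl⟩ := hi
    refine ⟨fun e => gridCell m n 0 (sideCell p false e), ?_⟩
    have h0 := isPath_alpha_strand hs hm p false
    have h1 := (isPath_alpha_strand hs hm p true).reverse
    simp only [Bool.not_false, Bool.not_true, beq_true, beq_false, Bool.not_not] at h0 h1
    refine ((h0.append (v := fun _ => none) ?_).append h1).append ?_
    · exact ⟨rfl, rfl, rfl⟩
    · refine ⟨?_, ?_, ?_⟩ <;> funext e <;> cases e <;>
        simp [cornerCell_zEnd hs, StrandDiagram.heegaard, BridgeDiagram.heegaard, endCell, sideCell]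
  · refine ⟨fun _ => none, IsPath.of_const fun P hP => ?_⟩
    simp only [StrandDiagram.heegaard, BridgeDiagram.heegaard, List.mem_append,
      List.mem_reverse] at hP
    rcases hP with ((hP | hP) | hP) | hP
    · obtain ⟨x, s, t, rfl⟩ := eq_cross_inl_of_mem_alphaSide hi hP
      exact ⟨rfl, rfl⟩
    · simp only [List.mem_cons, List.not_mem_nil, or_false] at hP
      rcases hP with rfl | rfl <;> exact ⟨rfl, rfl⟩
    · obtain ⟨x, s, t, rfl⟩ := eq_cross_inl_of_mem_alphaSide hi hP
      exact ⟨rfl, rfl⟩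
    · simp only [List.mem_cons, List.not_mem_nil, or_false] at hP
      rcases hP with rfl | rfl <;> simp only [cornerCell_zEnd_of_notMem m hi, and_self]

theorem isPath_beta (hs : Function.Injective D.strand) {m : ℕ} (hm : 0 < m) (j : Fin (T + 1)) :
    ∃ u, IsPath (fun P f => D.cornerCell m (P, !(D.heegaard m).pos P, f))
      (fun P f => D.cornerCell m (P, (D.heegaard m).pos P, f)) ((D.heegaard m).β j) u u := by
  by_cases hj : j ∈ Set.range D.strand
  · obtain ⟨q, rfl⟩ := hj
    refine ⟨fun f => gridCell m n (sideCell q true f) 0, ?_⟩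
    have h0 := isPath_beta_strand hs hm q false
    have h1 := (isPath_beta_strand hs hm q true).reverse
    simp only [Bool.not_false, Bool.not_true, beq_true, beq_false, Bool.not_not] at h0 h1
    refine ((h0.append (v := fun _ => none) ?_).append h1).append ?_
    · exact ⟨rfl, rfl, rfl⟩
    -- The two gaps beside the strand must get the same cell from the α- and the β-coordinates.
    · have e1 : gridCell m n (2 * (q : ℕ)) 0 = gridCell m n 0 (2 * q) :=
        (gridCell_swap (by omega) (by omega)).symm
      have e2 : gridCell m n (2 * (q : ℕ) + 1 + 1) 0 = gridCell m n 0 (2 * q + 1 + 1) :=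
        (gridCell_swap (by omega) (by omega)).symm
      refine ⟨?_, ?_, ?_⟩ <;> funext e <;> cases e <;>
        simp [cornerCell_zEnd hs, StrandDiagram.heegaard, BridgeDiagram.heegaard, endCell,
          sideCell, e1, e2]
  · refine ⟨fun _ => none, IsPath.of_const fun P hP => ?_⟩
    simp only [StrandDiagram.heegaard, BridgeDiagram.heegaard, List.mem_append,
      List.mem_reverse] at hP
    rcases hP with ((hP | hP) | hP) | hP
    · obtain ⟨x, s, t, rfl⟩ := eq_cross_inl_of_mem_betaSide hj hP
      exact ⟨rfl, rfl⟩
    · simp only [List.mem_cons, List.not_mem_nil, or_false] at hP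
      rcases hP with rfl | rfl <;> exact ⟨rfl, rfl⟩
    · obtain ⟨x, s, t, rfl⟩ := eq_cross_inl_of_mem_betaSide hj hP
      exact ⟨rfl, rfl⟩
    · simp only [List.mem_cons, List.not_mem_nil, or_false] at hP
      rcases hP with rfl | rfl <;> simp only [cornerCell_zEnd_of_notMem m hj, and_self]

theorem cornerCell_eq_of_adj (hs : Function.Injective D.strand) {m : ℕ} (hm : 0 < m)
    {c c' : Corner (BridgePoint T (X ⊕ (Fin m × Fin n × Fin n)))} (h : (D.heegaard m).Adj c c') :
    D.cornerCell m c = D.cornerCell m c' := by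
  cases h with
  | alpha i p q s h =>
    obtain ⟨u, hu⟩ := isPath_alpha hs hm i
    exact congrFun (h.out_eq_in hu) s
  | beta j p q t h =>
    obtain ⟨u, hu⟩ := isPath_beta hs hm j
    exact congrFun (h.out_eq_in hu) t

/-- The cell of the twist region containing a face. -/
noncomputable def faceCell (hs : Function.Injective D.strand) {m : ℕ} (hm : 0 < m) :
    (D.heegaard m).Face → Option (ℕ × ℕ × Bool) :=
  Quot.lift (D.cornerCell m) fun _ _ h => cornerCell_eq_of_adj hs hm h

/-! ### Points on the curves -/

theorem strand_eq_of_mem_alpha {m : ℕ} {i : Fin (T + 1)} {k : Fin m} {p q : Fin n} {s t : Bool}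
    (h : cross (Sum.inr (k, p, q)) s t ∈ (D.heegaard m).α i) : D.strand p = i := by
  simp [StrandDiagram.heegaard, BridgeDiagram.heegaard, twist,
     BridgeDiagram.mem_alphaSide] at h
  aesop

theorem strand_eq_of_mem_beta {m : ℕ} {i : Fin (T + 1)} {k : Fin m} {p q : Fin n} {s t : Bool}
    (h : cross (Sum.inr (k, p, q)) s t ∈ (D.heegaard m).β i) : D.strand q = i := by
  simp [StrandDiagram.heegaard, BridgeDiagram.heegaard, twist,
     BridgeDiagram.mem_betaSide] at h
  aesop

theorem cross_mem_alpha {m : ℕ} (k : Fin m) (p q : Fin n) (s t : Bool) :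
    cross (Sum.inr (k, p, q)) s t ∈ (D.heegaard m).α (D.strand p) := by
  cases s <;> cases t <;> simp [StrandDiagram.heegaard, BridgeDiagram.heegaard, twist,
     BridgeDiagram.mem_alphaSide]

theorem cross_mem_beta {m : ℕ} (k : Fin m) (p q : Fin n) (s t : Bool) :
    cross (Sum.inr (k, p, q)) s t ∈ (D.heegaard m).β (D.strand q) := by
  cases s <;> cases t <;> simp [StrandDiagram.heegaard, BridgeDiagram.heegaard, twist,
     BridgeDiagram.mem_betaSide]

theorem eq_of_zEnd_mem_alpha {m : ℕ} {i j : Fin (T + 1)} {s : Bool}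
    (h : zEnd j s ∈ (D.heegaard m).α i) : j = i := by
  simp [StrandDiagram.heegaard, BridgeDiagram.heegaard, twist,
     BridgeDiagram.mem_alphaSide] at h
  aesop

theorem eq_of_zEnd_mem_beta {m : ℕ} {i j : Fin (T + 1)} {s : Bool}
    (h : zEnd j s ∈ (D.heegaard m).β i) : j = i := by
  simp [StrandDiagram.heegaard, BridgeDiagram.heegaard, twist,
     BridgeDiagram.mem_betaSide] at h
  aesop

end StrandDiagram

/-! ### Multiplicities of the spiral -/

/-- The number of turns `i ≤ d` of a spiral with `x ≤ c + 2 n i`. -/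
def spiralCount (n c d x : ℕ) : ℕ := ∑ i ∈ Finset.range (d + 1), if x ≤ c + 2 * n * i then 1 else 0

section spiralCount

variable {n c d x : ℕ}

theorem spiralCount_of_le (h : x ≤ c) : spiralCount n c d x = d + 1 := by
  unfold spiralCount
  rw [Finset.sum_congr rfl fun i _ => if_pos (h.trans (Nat.le_add_right _ _))]
  simp

theorem spiralCount_of_lt (h : c < x) (h' : x ≤ c + 2 * n) : spiralCount n c d x = d := by
  unfold spiralCount
  rw [Finset.sum_range_succ', if_neg (by simpa using h), Finset.sum_congr rfl fun i _ => if_pos ?_]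
  · simp
  · rw [Nat.mul_succ]
    omega

theorem spiralCount_eq_zero (hc : c < 2 * n) (h : 2 * n * (d + 1) ≤ x) :
    spiralCount n c d x = 0 := by
  refine Finset.sum_eq_zero fun i hi => if_neg ?_
  have : 2 * n * i ≤ 2 * n * d := Nat.mul_le_mul_left _ (by simpa [Nat.lt_succ_iff] using hi)
  rw [Nat.mul_succ] at h
  omega

/-- Moving out by one full turn shifts the index `i` by one and loses exactly the last term. -/
theorem spiralCount_add (hc : c < 2 * n) :
    spiralCount n c d x = spiralCount n c d (x + 2 * n) + if x ≤ c + 2 * n * d then 1 else 0 := by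
  unfold spiralCount
  rw [Finset.sum_range_succ, Finset.sum_range_succ' _ d,
    if_neg (c := x + 2 * n ≤ c + 2 * n * 0) (by omega), add_zero]
  congr 1
  refine Finset.sum_congr rfl fun i _ => ?_
  have : x + 2 * n ≤ c + 2 * n * (i + 1) ↔ x ≤ c + 2 * n * i := by rw [Nat.mul_succ]; omega
  simp only [this]

end spiralCount

/-- The multiplicity of the spiral in the cell with coordinates `b` and `a`. -/
def spiralMult (n c d b a : ℕ) : ℕ := spiralCount n c d (b + if c < a then 2 * n else 0)

section spiralMult

variable {n c d : ℕ}

theorem spiralMult_wrap (hc : c < 2 * n) (b : ℕ) :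
    spiralMult n c d b (2 * n) = spiralMult n c d (b + 2 * n) 0 := by
  simp [spiralMult, hc]

theorem spiralMult_zero_of_le {a : ℕ} (h : a ≤ c) : spiralMult n c d 0 a = d + 1 := by
  rw [spiralMult, if_neg h.not_gt, spiralCount_of_le (Nat.zero_le _)]

theorem spiralMult_zero_of_lt {a : ℕ} (hc : c < 2 * n) (h : c < a) : spiralMult n c d 0 a = d := by
  rw [spiralMult, if_pos h, spiralCount_of_lt] <;> omega

/-- Odd `a` is included: the bigon at z and the two band starts next to it share one multiplicity.
-/
theorem spiralMult_swap (hc : c < 2 * n) {a : ℕ} (ha : a ≤ 2 * n) :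
    spiralMult n c d a 0 = spiralMult n c d 0 a := by
  rcases le_or_gt a c with h | h
  · rw [spiralMult_zero_of_le h, spiralMult, if_neg (Nat.not_lt_zero _),
      spiralCount_of_le (by simpa using h)]
  · rw [spiralMult_zero_of_lt hc h, spiralMult, if_neg (Nat.not_lt_zero _),
      spiralCount_of_lt] <;> omega

theorem spiralMult_eq_zero (hc : c < 2 * n) {b a : ℕ} (h : 2 * n * (d + 1) ≤ b) :
    spiralMult n c d b a = 0 :=
  spiralCount_eq_zero hc (h.trans (Nat.le_add_right _ _))

theorem spiralMult_zero_antitone (hc : c < 2 * n) : Antitone (spiralMult n c d 0) := by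
  intro a a' h
  rcases le_or_gt a' c with h' | h'
  · rw [spiralMult_zero_of_le h', spiralMult_zero_of_le (h.trans h')]
  · rw [spiralMult_zero_of_lt hc h']
    rcases le_or_gt a c with h'' | h''
    · rw [spiralMult_zero_of_le h'']; omega
    · rw [spiralMult_zero_of_lt hc h'']

theorem spiralMult_succ_of_ne {a : ℕ} (b : ℕ) (h : a ≠ c) :
    spiralMult n c d b (a + 1) = spiralMult n c d b a := by
  have : c < a + 1 ↔ c < a := by omega
  simp [spiralMult, this]

/-- The α-arc of the loop lies on angular line `c`, from the centre to row `c + 2 * n * d`; crossing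
it changes the winding number by one. -/
theorem spiralMult_line (hc : c < 2 * n) (b : ℕ) :
    spiralMult n c d b c =
      spiralMult n c d b (c + 1) + if b ≤ c + 2 * n * d then 1 else 0 := by
  simp only [spiralMult, lt_self_iff_false, if_false, add_zero, Nat.lt_succ_self, if_true]
  exact spiralCount_add hc

end spiralMult

/-- The multiplicity of the spiral in a cell of the twist region. -/
def cellMult (n c d : ℕ) : Option (ℕ × ℕ × Bool) → ℕ
  | none => 0
  | some (b, a, _) => spiralMult n c d b a

/-- Wrap and swap preserve the multiplicity, and the rows merged with the exterior begin where the
spiral has ended. For this the spiral stops one turn short of the boundary, whence `d + 2` turns. -/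
theorem StrandDiagram.cellMult_gridCell {n c d : ℕ} (hc : c < 2 * n) (b a : ℕ) :
    cellMult n c d (gridCell (d + 2) n b a) = spiralMult n c d b a := by
  have key : ∀ p : ℕ × ℕ, spiralMult n c d p.1 p.2 = spiralMult n c d b a →
      cellMult n c d (if p.1 < 2 * n * (d + 2 - 1) then some (p.1, p.2, false) else none) =
        spiralMult n c d b a := by
    intro p h
    split_ifs with hb
    · exact h
    · rw [← h, spiralMult_eq_zero hc (not_lt.1 hb)]
      rfl
  refine key _ ?_
  split_ifs with h0 h1 h2
  · rw [spiralMult_wrap hc, h0, Nat.sub_add_cancel h1]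
  · rw [h0, spiralMult_swap hc (by omega)]
  · rw [h0]
  · rfl

/-! ### Sums over the grid -/

theorem sum_range_shift (g : ℕ → ℚ) (L w : ℕ) (h : ∀ R, L ≤ R → g R = 0) :
    ∑ R ∈ Finset.range L, (g (R + w) - g R) = -∑ R ∈ Finset.range w, g R := by
  have h1 := Finset.sum_range_add g L w
  have h2 := Finset.sum_range_add g w L
  rw [add_comm w L, h1] at h2
  rw [Finset.sum_eq_zero (s := Finset.range w) (f := fun x => g (L + x))
    fun x _ => h _ (Nat.le_add_right _ _)] at h2
  rw [Finset.sum_sub_distrib, Finset.sum_congr rfl fun R _ => congrArg g (add_comm R w)]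
  linarith

/-- The summand is four times a cell minus the four cells around a grid vertex, as in four times the
Euler measure. It telescopes radially and, through the wrap `hw`, angularly, so only terms near the
centre survive. -/
theorem sum_grid (f : ℕ → ℕ → ℚ) (L w : ℕ) (hw : ∀ R, f R w = f (R + w) 0)
    (hL : ∀ R a, L ≤ R → f R a = 0) :
    ∑ R ∈ Finset.range L, ∑ A ∈ Finset.range w,
        (3 * f (R + 1) (A + 1) - f R A - f R (A + 1) - f (R + 1) A) =
      -2 * ∑ A ∈ Finset.range w, f 0 (A + 1) - ∑ R ∈ Finset.range w, f R 0 -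
        ∑ R ∈ Finset.range w, f (R + 1) 0 := by
  have h1 : ∀ R, ∑ A ∈ Finset.range w,
      (3 * f (R + 1) (A + 1) - f R A - f R (A + 1) - f (R + 1) A) =
      2 * ∑ A ∈ Finset.range w, (f (R + 1) (A + 1) - f R (A + 1)) +
        (f (R + w) 0 - f R 0) + (f (R + w + 1) 0 - f (R + 1) 0) := by
    intro R
    have e1 := Finset.sum_range_sub (f R) w
    have e2 := Finset.sum_range_sub (f (R + 1)) w
    rw [hw] at e1 e2
    rw [add_right_comm] at e2
    rw [← e1, ← e2, Finset.mul_sum, ← Finset.sum_add_distrib, ← Finset.sum_add_distrib]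
    exact Finset.sum_congr rfl fun A _ => by ring
  rw [Finset.sum_congr rfl fun R _ => h1 R, Finset.sum_add_distrib, Finset.sum_add_distrib,
    sum_range_shift (fun R => f R 0) L w fun R h => hL R 0 h,
    sum_range_shift (fun R => f (R + 1) 0) L w fun R h => hL _ 0 (by omega),
    ← Finset.mul_sum, Finset.sum_comm]
  have h2 : ∀ A ∈ Finset.range w, ∑ R ∈ Finset.range L, (f (R + 1) (A + 1) - f R (A + 1)) =
      -f 0 (A + 1) := fun A _ => by
    rw [Finset.sum_range_sub fun R => f R (A + 1), hL L _ le_rfl, zero_sub]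
  rw [Finset.sum_congr rfl h2, Finset.sum_neg_distrib]
  ring

namespace StrandDiagram

theorem sum_sideCell (h : ℕ → ℚ) (n : ℕ) :
    ∑ p ∈ Finset.range n, ∑ s : Bool, ∑ e : Bool, h (sideCell p s e) =
      ∑ A ∈ Finset.range (2 * n), (h A + h (A + 1)) := by
  induction n with
  | zero => simp
  | succ n ih =>
    rw [Finset.sum_range_succ, ih, Nat.mul_succ, Finset.sum_range_succ, Finset.sum_range_succ]
    simp [sideCell]
    ring

theorem sum_level (h : ℕ → ℚ) (m n : ℕ) :
    ∑ k : Fin m, ∑ q : Fin n, h (level k q) = ∑ r ∈ Finset.range (m * n), h r := by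
  have : ∀ m, ∑ k ∈ Finset.range m, ∑ q ∈ Finset.range n, h (k * n + q) =
      ∑ r ∈ Finset.range (m * n), h r := by
    intro m
    induction m with
    | zero => simp
    | succ m ih => rw [Finset.sum_range_succ, ih, Nat.add_one_mul, Finset.sum_range_add]
  rw [← this, ← Finset.sum_range_reflect, Finset.sum_range]
  exact Finset.sum_congr rfl fun k _ => by rw [Finset.sum_range]; rfl

/-- Each side of a band is a grid line, so the points at crossings are grid vertices and their
corners are the four surrounding cells. -/
theorem sum_grid_corners (f : ℕ → ℕ → ℚ) (m n : ℕ) :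
    ∑ k : Fin m, ∑ p : Fin n, ∑ q : Fin n, ∑ s : Bool, ∑ t : Bool, ∑ e : Bool, ∑ g : Bool,
        f (sideCell (level k q) (!t) g) (sideCell p s e) =
      ∑ R ∈ Finset.range (2 * (m * n)), ∑ A ∈ Finset.range (2 * n),
        (f R A + f R (A + 1) + (f (R + 1) A + f (R + 1) (A + 1))) := by
  have h1 : ∀ b, ∑ p : Fin n, ∑ s : Bool, ∑ e : Bool, f b (sideCell p s e) =
      ∑ A ∈ Finset.range (2 * n), (f b A + f b (A + 1)) := fun b => by
    rw [← sum_sideCell, Finset.sum_range]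
  simp_rw [Finset.sum_add_distrib (f := fun A => f _ A + f _ (A + 1)), ← h1]
  rw [← sum_sideCell (fun b => ∑ p : Fin n, ∑ s : Bool, ∑ e : Bool, f b (sideCell p s e)) (m * n),
    ← sum_level]
  refine Finset.sum_congr rfl fun k _ => ?_
  rw [Finset.sum_comm]
  refine Finset.sum_congr rfl fun q _ => ?_
  simp only [Fintype.sum_bool, Bool.not_true, Bool.not_false, ← Finset.sum_add_distrib]
  exact Finset.sum_congr rfl fun p _ => by ring

theorem exists_sideCell (R : ℕ) :
    ∃ s : Bool, ∀ u : Bool, sideCell (R / 2) s (xor s u) = R + u.toNat := by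
  refine ⟨decide (R % 2 = 1), fun u => ?_⟩
  unfold sideCell
  rcases Nat.mod_two_eq_zero_or_one R with h | h <;> cases u <;> simp [h] <;> omega

theorem exists_level {m n r : ℕ} (h : r < m * n) : ∃ (k : Fin m) (q : Fin n), level k q = r := by
  have hn : 0 < n := Nat.pos_of_ne_zero (by rintro rfl; simp at h)
  have h1 : r / n < m := Nat.div_lt_of_lt_mul (by rwa [mul_comm])
  obtain ⟨x, hx⟩ : ∃ x, r / n = x := ⟨_, rfl⟩
  rw [hx] at h1
  refine ⟨⟨m - 1 - x, by omega⟩, ⟨r % n, Nat.mod_lt _ hn⟩, ?_⟩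
  have : m - 1 - (m - 1 - x) = x := by omega
  simp only [level, this]
  rw [← hx, Nat.div_add_mod']

end StrandDiagram

/-! ### Euler measure -/

/-- Grouping corners by face replaces the corner count of each polygon by one sum over all corners.
-/
theorem HeegaardDiagram.Domain.eulerMeasure_eq {T : ℕ} {P : Type} {H : HeegaardDiagram T P}
    [Fintype P] [Fintype H.Face] {x y : H.State} (φ : H.Domain x y) :
    φ.eulerMeasure = ∑ f : H.Face, (φ.mult f : ℚ) -
      (∑ c : Corner P, (φ.mult (H.face c) : ℚ)) / 4 := by
  classical
  have h : ∑ c : Corner P, (φ.mult (H.face c) : ℚ) =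
      ∑ f : H.Face, (φ.mult f : ℚ) * Nat.card {c : Corner P // H.face c = f} := by
    rw [← Finset.sum_fiberwise Finset.univ H.face]
    refine Finset.sum_congr rfl fun f _ => ?_
    rw [Finset.sum_congr rfl fun c hc => by rw [(Finset.mem_filter.1 hc).2], Finset.sum_const,
      nsmul_eq_mul, mul_comm, Nat.card_eq_fintype_card, Fintype.card_subtype]
  rw [eulerMeasure, finsum_eq_sum_of_fintype, h, Finset.sum_div, ← Finset.sum_sub_distrib]
  exact Finset.sum_congr rfl fun f _ => by ring

/-- Bounds a sum over faces from below by any list of distinct cells that occur, without classifying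
the faces. -/
theorem sum_comp_le_of_injective {ι α β : Type*} [Fintype ι] [Fintype α] {F : β → ℚ}
    (hF : ∀ b, 0 ≤ F b) (g : α → β) (e : ι → β) (he : Function.Injective e)
    (hr : ∀ i, ∃ a, g a = e i) : ∑ i, F (e i) ≤ ∑ a, F (g a) := by
  choose a ha using hr
  have hinj : Function.Injective a := fun i j h => he (by rw [← ha i, ← ha j, h])
  calc ∑ i, F (e i) = ∑ b ∈ Finset.univ.map ⟨a, hinj⟩, F (g b) := by simp [ha]
    _ ≤ ∑ b, F (g b) := Finset.sum_le_univ_sum_of_nonneg fun b => hF _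

/-! ### Corner sums and the Euler estimate for the spiral. -/

namespace BridgePoint

/-- The points of the Heegaard diagram of a bridge diagram, as a disjoint union. -/
def equivSum (T : ℕ) (X : Type) :
    (X × Bool × Bool) ⊕ (Fin (T + 1) × Bool) ⊕ (Fin (T + 1) × Bool) ≃ BridgePoint T X where
  toFun
    | Sum.inl (x, s, t) => cross x s t
    | Sum.inr (Sum.inl (i, s)) => zEnd i s
    | Sum.inr (Sum.inr (i, s)) => wEnd i s
  invFun
    | cross x s t => Sum.inl (x, s, t)
    | zEnd i s => Sum.inr (Sum.inl (i, s))
    | wEnd i s => Sum.inr (Sum.inr (i, s))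
  left_inv := by rintro (_ | _ | _) <;> rfl
  right_inv := by rintro (_ | _ | _) <;> rfl

instance instFintype (T : ℕ) (X : Type) [Fintype X] : Fintype (BridgePoint T X) :=
  Fintype.ofEquiv _ (equivSum T X)

theorem sum_eq {T : ℕ} {X : Type} [Fintype X] (h : BridgePoint T X → ℚ) :
    ∑ P, h P = ∑ x, ∑ s, ∑ t, h (cross x s t) +
      (∑ i, ∑ s, h (zEnd i s) + ∑ i, ∑ s, h (wEnd i s)) := by
  rw [← (equivSum T X).sum_comp]
  simp only [Fintype.sum_sum_type, Fintype.sum_prod_type]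
  rfl

end BridgePoint

namespace StrandDiagram

open BridgePoint

variable {T n : ℕ} {X : Type} {D : StrandDiagram T n X}

theorem cellMult_none (n c d : ℕ) : cellMult n c d none = 0 := rfl

theorem cellMult_endCell {c d : ℕ} (hc : c < 2 * n) {p : ℕ} (hp : p < n) (s e f : Bool) :
    cellMult n c d (endCell (d + 2) n p s e f) =
      spiralMult n c d 0 (if e || f then 2 * p + 1 else sideCell p s false) := by
  cases e <;> cases f <;> simp only [endCell, cellMult_gridCell hc] <;> try rfl
  exact spiralMult_swap hc (by omega)

theorem sum_cornerCell [Fintype X] (hs : Function.Injective D.strand) {c d : ℕ}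
    (hc : c < 2 * n) :
    ∑ P : Corner (BridgePoint T (X ⊕ (Fin (d + 2) × Fin n × Fin n))),
        (cellMult n c d (D.cornerCell (d + 2) P) : ℚ) =
      ∑ R ∈ Finset.range (2 * ((d + 2) * n)), ∑ A ∈ Finset.range (2 * n),
        ((spiralMult n c d R A : ℚ) + spiralMult n c d R (A + 1) +
          (spiralMult n c d (R + 1) A + spiralMult n c d (R + 1) (A + 1))) +
      ∑ p ∈ Finset.range n, (6 * (spiralMult n c d 0 (2 * p + 1) : ℚ) +
        spiralMult n c d 0 (2 * p) + spiralMult n c d 0 (2 * p + 2)) := by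
  rw [Fintype.sum_prod_type, BridgePoint.sum_eq]
  simp only [Fintype.sum_prod_type (α₁ := Bool), Fintype.sum_sum_type]
  rw [← sum_grid_corners (fun b a => (spiralMult n c d b a : ℚ)) (d + 2) n]
  simp only [Fintype.sum_prod_type (α₁ := Fin (d + 2)), Fintype.sum_prod_type (α₁ := Fin n)]
  have hz : ∑ i : Fin (T + 1), ∑ s : Bool, ∑ e : Bool, ∑ f : Bool,
      (cellMult n c d (D.cornerCell (d + 2) (zEnd i s, e, f)) : ℚ) =
      ∑ p ∈ Finset.range n, (6 * (spiralMult n c d 0 (2 * p + 1) : ℚ) +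
        spiralMult n c d 0 (2 * p) + spiralMult n c d 0 (2 * p + 2)) := by
    rw [Finset.sum_range]
    refine (Fintype.sum_of_injective D.strand hs _ _ (fun i hi => ?_) fun p => ?_).symm
    · simp [cornerCell_zEnd_of_notMem (d + 2) hi, cellMult_none]
    -- Of the eight corners at a strand end, six lie in the bigon or in a band start; the other two
    -- lie in the neighbouring gaps.
    · simp only [cornerCell_zEnd hs, cellMult_endCell hc p.2, Fintype.sum_bool]
      simp [sideCell]
      ring
  rw [hz]
  simp [cornerCell, cellMult_none, cellMult_gridCell hc]

theorem exists_cornerCell_eq_gridCell {m R A : ℕ} (hR : R < 2 * (m * n)) (hA : A < 2 * n)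
    (u v : Bool) : ∃ P, D.cornerCell m P = gridCell m n (R + u.toNat) (A + v.toNat) := by
  obtain ⟨s, hs⟩ := exists_sideCell A
  obtain ⟨t, ht⟩ := exists_sideCell R
  obtain ⟨k, q, hk⟩ := exists_level (m := m) (n := n) (r := R / 2) (by omega)
  refine ⟨(cross (Sum.inr (k, ⟨A / 2, by omega⟩, q)) s (!t), xor s v, xor t u), ?_⟩
  rw [← hs, ← ht]
  simp [cornerCell, hk]

theorem gridCell_eq_some {m b a : ℕ} (ha : a ≠ 0) (hb : b < 2 * n * (m - 1)) :
    gridCell m n b a = some (b, a, false) := by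
  simp [gridCell, ha, hb]

theorem le_sum_cornerCell {c d : ℕ} (hc : c < 2 * n) (hs : Function.Injective D.strand)
    {α : Type} [Fintype α] (g : α → Option (ℕ × ℕ × Bool))
    (hg : ∀ P, ∃ a, g a = D.cornerCell (d + 2) P) :
    ∑ R ∈ Finset.range (2 * ((d + 2) * n)), ∑ A ∈ Finset.range (2 * n),
        (spiralMult n c d (R + 1) (A + 1) : ℚ) +
      (∑ a ∈ Finset.range (2 * n + 1), (spiralMult n c d 0 a : ℚ) +
        2 * ∑ p ∈ Finset.range n, (spiralMult n c d 0 (2 * p + 1) : ℚ)) ≤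
      ∑ a, (cellMult n c d (g a) : ℚ) := by
  -- Four families of distinct cells: those off the centre, the central row, the starts of the
  -- overstrand bands, and the bigons.
  let e : (Fin (2 * n * (d + 1) - 1) × Fin (2 * n)) ⊕ Fin (2 * n + 1) ⊕ Fin n ⊕ Fin n →
      Option (ℕ × ℕ × Bool)
    | Sum.inl (R, A) => some (R + 1, A + 1, false)
    | Sum.inr (Sum.inl a) => some (0, a, false)
    | Sum.inr (Sum.inr (Sum.inl p)) => some (2 * p + 1, 0, false)
    | Sum.inr (Sum.inr (Sum.inr p)) => some (0, 2 * p + 1, true)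
  have hn : 0 < n := by omega
  have hN : 2 * n ≤ 2 * n * (d + 1) := Nat.le_mul_of_pos_right _ (Nat.succ_pos _)
  have hN' : 2 * ((d + 2) * n) = 2 * n * (d + 1) + 2 * n := by ring
  have he : Function.Injective e := by
    rintro (⟨R, A⟩ | a | p | p) (⟨R', A'⟩ | a' | p' | p') h <;>
      simp only [e, Option.some.injEq, Prod.mk.injEq, reduceCtorEq, and_false, false_and, and_true,
        true_and] at h <;>
      simp only [Sum.inl.injEq, Sum.inr.injEq, Prod.mk.injEq, Fin.ext_iff] <;> omega
  have hr : ∀ i, ∃ P, D.cornerCell (d + 2) P = e i := by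
    rintro (⟨R, A⟩ | a | p | p)
    · obtain ⟨P, hP⟩ := exists_cornerCell_eq_gridCell (D := D) (m := d + 2) (R := R) (A := A)
        (by omega) A.2 true true
      refine ⟨P, hP.trans (gridCell_eq_some (Nat.succ_ne_zero _) ?_)⟩
      have := R.2
      change (R : ℕ) + 1 < 2 * n * (d + 1)
      omega
    · rcases Nat.eq_zero_or_pos (a : ℕ) with h | h
      · obtain ⟨P, hP⟩ := exists_cornerCell_eq_gridCell (D := D) (m := d + 2) (R := 0) (A := 0)
          (by omega) (by omega) false false
        refine ⟨P, hP.trans ?_⟩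
        simp [e, h, gridCell, hn.ne']
      · obtain ⟨P, hP⟩ := exists_cornerCell_eq_gridCell (D := D) (m := d + 2) (R := 0)
          (A := a - 1) (by omega) (by omega) false true
        refine ⟨P, hP.trans ?_⟩
        have : (a : ℕ) - 1 + 1 = a := by omega
        simp only [Bool.toNat_true, Bool.toNat_false, this]
        exact gridCell_eq_some h.ne' (by simp only [Nat.add_one_sub_one]; omega)
    · refine ⟨(zEnd (D.strand p) false, false, true), ?_⟩
      have h1 : ¬ 2 * n ≤ 2 * (p : ℕ) + 1 := by omega
      have h2 : 2 * (p : ℕ) + 1 < 2 * n * (d + 1) := by omega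
      simp [cornerCell_zEnd hs, endCell, gridCell, e, h1, h2]
    · exact ⟨(zEnd (D.strand p) false, true, true), cornerCell_zEnd hs _ _ _ _ _⟩
  have key := sum_comp_le_of_injective (F := fun b => (cellMult n c d b : ℚ))
    (fun b => Nat.cast_nonneg _) g e he fun i => by
      obtain ⟨P, hP⟩ := hr i
      obtain ⟨a, ha⟩ := hg P
      exact ⟨a, ha.trans hP⟩
  refine le_trans (le_of_eq ?_) key
  simp only [Fintype.sum_sum_type, Fintype.sum_prod_type, e, cellMult]
  rw [Finset.sum_range, ← Finset.sum_range (n := 2 * n + 1) fun a => (spiralMult n c d 0 a : ℚ),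
    ← Finset.sum_range (n := n) fun p => (spiralMult n c d (2 * p + 1) 0 : ℚ),
    ← Finset.sum_range (n := n) fun p => (spiralMult n c d 0 (2 * p + 1) : ℚ),
    ← Finset.sum_range fun R => ∑ A ∈ Finset.range (2 * n),
      (spiralMult n c d (R + 1) (A + 1) : ℚ)]
  have h1 : ∀ R, ∑ A : Fin (2 * n), (spiralMult n c d (R + 1) (A + 1) : ℚ) =
      ∑ A ∈ Finset.range (2 * n), (spiralMult n c d (R + 1) (A + 1) : ℚ) := fun R => by
    rw [Finset.sum_range]
  simp only [h1]
  rw [← Finset.sum_range fun R => ∑ A ∈ Finset.range (2 * n),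
      (spiralMult n c d (R + 1) (A + 1) : ℚ)]
  congr 1
  · symm
    refine Finset.sum_subset (Finset.range_subset_range.2 (by omega)) fun R _ hR => ?_
    refine Finset.sum_eq_zero fun A _ => ?_
    rw [Finset.mem_range] at hR
    rw [spiralMult_eq_zero hc (by omega), Nat.cast_zero]
  · have h2 : ∑ p ∈ Finset.range n, (spiralMult n c d (2 * p + 1) 0 : ℚ) =
        ∑ p ∈ Finset.range n, (spiralMult n c d 0 (2 * p + 1) : ℚ) :=
      Finset.sum_congr rfl fun p hp => by
        rw [Finset.mem_range] at hp
        rw [spiralMult_swap hc (by omega)]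
    rw [h2]
    ring

/-- Let f be the multiplicity on the central row. After telescoping, four times the right-hand side
is at least 3 f(0) + f(2n) + Σ (2 f(2p+1) - f(2p) - f(2p+2)). The first two terms give 4d + 3. As f
is antitone, the sum is at least f(2n) - f(0) = -1. -/
theorem euler_bound [Fintype X] {c d : ℕ} (hc : c < 2 * n) (hs : Function.Injective D.strand)
    {α : Type} [Fintype α] (g : α → Option (ℕ × ℕ × Bool))
    (hg : ∀ P, ∃ a, g a = D.cornerCell (d + 2) P) :
    (d : ℚ) ≤ ∑ a, (cellMult n c d (g a) : ℚ) -
      (∑ P : Corner (BridgePoint T (X ⊕ (Fin (d + 2) × Fin n × Fin n))),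
        (cellMult n c d (D.cornerCell (d + 2) P) : ℚ)) / 4 := by
  have h1 := le_sum_cornerCell hc hs g hg
  have h2 := sum_cornerCell (X := X) hs hc (d := d)
  have h3 := sum_grid (fun b a => (spiralMult n c d b a : ℚ)) (2 * ((d + 2) * n)) (2 * n)
    (fun R => by rw [spiralMult_wrap hc]) fun R a h => by
      rw [spiralMult_eq_zero hc, Nat.cast_zero]
      refine le_trans ?_ h
      rw [mul_assoc, mul_comm n]
      gcongr
      omega
  have h4 : ∀ R ∈ Finset.range (2 * n), (spiralMult n c d R 0 : ℚ) = spiralMult n c d 0 R := by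
    intro R hR
    rw [spiralMult_swap hc (Finset.mem_range.1 hR).le]
  have h5 : ∀ R ∈ Finset.range (2 * n),
      (spiralMult n c d (R + 1) 0 : ℚ) = spiralMult n c d 0 (R + 1) := by
    intro R hR
    rw [spiralMult_swap hc (Finset.mem_range.1 hR)]
  rw [Finset.sum_congr rfl h4, Finset.sum_congr rfl h5] at h3
  have h6 := Finset.sum_range_succ (fun a => (spiralMult n c d 0 a : ℚ)) (2 * n)
  have h7 := Finset.sum_range_succ' (fun a => (spiralMult n c d 0 a : ℚ)) (2 * n)
  have h8 : ∑ p ∈ Finset.range n, ((spiralMult n c d 0 (2 * (p + 1)) : ℚ) -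
        spiralMult n c d 0 (2 * p)) ≤
      ∑ p ∈ Finset.range n, (2 * (spiralMult n c d 0 (2 * p + 1) : ℚ) -
        spiralMult n c d 0 (2 * p) - spiralMult n c d 0 (2 * p + 2)) := by
    refine Finset.sum_le_sum fun p _ => ?_
    have : (spiralMult n c d 0 (2 * (p + 1)) : ℚ) ≤ spiralMult n c d 0 (2 * p + 1) :=
      Nat.cast_le.2 (spiralMult_zero_antitone hc (by omega))
    rw [Nat.mul_succ] at this ⊢
    linarith
  rw [Finset.sum_range_sub fun p => (spiralMult n c d 0 (2 * p) : ℚ), mul_zero] at h8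
  have h9 : (spiralMult n c d 0 0 : ℚ) = d + 1 := by
    rw [spiralMult_zero_of_le (Nat.zero_le _)]; push_cast; ring
  have h10 : (spiralMult n c d 0 (2 * n) : ℚ) = d := by
    rw [spiralMult_zero_of_lt hc hc]
  simp only [Finset.sum_add_distrib, Finset.sum_sub_distrib, ← Finset.mul_sum] at *
  linarith

end StrandDiagram

/-! ### The spiral as a domain between two states. -/

theorem spiralCount_succ {n c d x : ℕ} (hc : c < 2 * n) (h : x % (2 * n) ≠ c) :
    spiralCount n c d (x + 1) = spiralCount n c d x := by
  refine Finset.sum_congr rfl fun i _ => ?_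
  have h1 : x ≠ c + 2 * n * i := by
    rintro rfl
    rw [Nat.add_mul_mod_self_left, Nat.mod_eq_of_lt hc] at h
    exact h rfl
  have h2 : x + 1 ≤ c + 2 * n * i ↔ x ≤ c + 2 * n * i := by omega
  simp only [h2]

/-- The β-arc of the loop occupies only the radial lines congruent to `c` modulo `2 * n`. -/
theorem spiralMult_succ_left {n c d b a : ℕ} (hc : c < 2 * n) (h : b % (2 * n) ≠ c) :
    spiralMult n c d (b + 1) a = spiralMult n c d b a := by
  unfold spiralMult
  rw [add_right_comm]
  refine spiralCount_succ hc ?_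
  split_ifs <;> simpa using h

open Classical in
theorem HeegaardDiagram.State.ind_sub_ind {T : ℕ} {P : Type} {H : HeegaardDiagram T P}
    {x y : H.State} {l : Fin T} {Y : P} (hy : y.1 = Function.update x.1 l Y)
    (hx : ∀ l', l' ≠ l → x.1 l' ≠ x.1 l) (hY : ∀ l', l' ≠ l → x.1 l' ≠ Y) (p : P) :
    y.ind p - x.ind p = (if p = Y then 1 else 0) - (if p = x.1 l then 1 else 0) := by
  have h1 : p ∈ Set.range y.1 ↔ p = Y ∨ ∃ l', l' ≠ l ∧ x.1 l' = p := by
    rw [hy]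
    constructor
    · rintro ⟨l', rfl⟩
      by_cases h : l' = l
      · subst h; simp
      · exact Or.inr ⟨l', h, by simp [h]⟩
    · rintro (rfl | ⟨l', h, rfl⟩)
      · exact ⟨l, by simp⟩
      · exact ⟨l', by simp [h]⟩
  have h2 : p ∈ Set.range x.1 ↔ p = x.1 l ∨ ∃ l', l' ≠ l ∧ x.1 l' = p := by
    constructor
    · rintro ⟨l', rfl⟩
      by_cases h : l' = l
      · subst h; simp
      · exact Or.inr ⟨l', h, rfl⟩
    · rintro (rfl | ⟨l', h, rfl⟩)
      · exact ⟨l, rfl⟩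
      · exact ⟨l', rfl⟩
  unfold ind
  simp only [h1, h2]
  by_cases h : ∃ l', l' ≠ l ∧ x.1 l' = p
  · obtain ⟨l', h, rfl⟩ := h
    rw [if_neg (hY l' h), if_neg (hx l' h), if_pos (Or.inr ⟨l', h, rfl⟩),
      if_pos (Or.inr ⟨l', h, rfl⟩)]
    rfl
  · simp only [h, or_false]

namespace StrandDiagram

open BridgePoint

variable {T n : ℕ} {X : Type} {D : StrandDiagram T n X}

theorem level_mod {m : ℕ} (k : Fin m) (q : Fin n) : level k q % n = q := by
  rw [level, add_comm, Nat.add_mul_mod_self_right, Nat.mod_eq_of_lt q.2]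

theorem level_inj {m : ℕ} {k k' : Fin m} {q q' : Fin n} (h : level k q = level k' q') :
    k = k' ∧ q = q' := by
  have hq : q = q' := Fin.ext (by rw [← level_mod k q, h, level_mod])
  subst hq
  have h1 : (m - 1 - k) * n = (m - 1 - k') * n := Nat.add_right_cancel h
  have := Nat.eq_of_mul_eq_mul_right q.pos h1
  exact ⟨Fin.ext (by omega), rfl⟩

theorem line_mod {m : ℕ} (k : Fin m) (q : Fin n) (u : Bool) :
    (2 * level k q + u.toNat) % (2 * n) = 2 * q + u.toNat := by
  have h : 2 * level k q + u.toNat = 2 * q + u.toNat + 2 * n * (m - 1 - k) := by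
    rw [level]; ring
  have := Bool.toNat_lt u
  rw [h, Nat.add_mul_mod_self_left, Nat.mod_eq_of_lt (by omega)]

/-- The multiplicity of the spiral at a corner. -/
noncomputable def cornerMult (D : StrandDiagram T n X) (c d : ℕ)
    (P : Corner (BridgePoint T (X ⊕ (Fin (d + 2) × Fin n × Fin n)))) : ℤ :=
  cellMult n c d (D.cornerCell (d + 2) P)

section cornerMult

variable {c d : ℕ}

theorem cornerMult_cross_inl (x : X) (s t e f : Bool) :
    D.cornerMult c d (cross (Sum.inl x) s t, e, f) = 0 := rfl

theorem cornerMult_wEnd (i : Fin (T + 1)) (s e f : Bool) :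
    D.cornerMult c d (wEnd i s, e, f) = 0 := rfl

theorem cornerMult_cross_inr (hc : c < 2 * n) (k : Fin (d + 2)) (p q : Fin n) (s t e f : Bool) :
    D.cornerMult c d (cross (Sum.inr (k, p, q)) s t, e, f) =
      spiralMult n c d (sideCell (level k q) (!t) f) (sideCell p s e) := by
  rw [cornerMult, cornerCell, cellMult_gridCell hc]

theorem cornerMult_zEnd_of_notMem {i : Fin (T + 1)} (hi : i ∉ Set.range D.strand)
    (s e f : Bool) : D.cornerMult c d (zEnd i s, e, f) = 0 := by
  rw [cornerMult, cornerCell_zEnd_of_notMem _ hi]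
  rfl

theorem cornerMult_zEnd (hs : Function.Injective D.strand) (hc : c < 2 * n) (p : Fin n)
    (s e f : Bool) : D.cornerMult c d (zEnd (D.strand p) s, e, f) =
      spiralMult n c d 0 (if e || f then 2 * p + 1 else sideCell p s false) := by
  rw [cornerMult, cornerCell_zEnd hs, cellMult_endCell hc p.2]

/-- The boundary of the spiral along the `α`-curves, at a crossing. -/
theorem cornerMult_boundary_cross (hc : c < 2 * n) {j : Fin n} {s : Bool}
    (hj : c = 2 * j + s.toNat) (k : Fin (d + 2)) (p q : Fin n) (s' t' : Bool) :
    (D.cornerMult c d (cross (Sum.inr (k, p, q)) s' t', true, s' == t') -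
        D.cornerMult c d (cross (Sum.inr (k, p, q)) s' t', false, s' == t')) -
      (D.cornerMult c d (cross (Sum.inr (k, p, q)) s' t', true, !(s' == t')) -
        D.cornerMult c d (cross (Sum.inr (k, p, q)) s' t', false, !(s' == t'))) =
    -(if k = 1 ∧ p = j ∧ q = j ∧ s' = s ∧ t' = !s then 1 else 0) := by
  simp only [cornerMult_cross_inr hc]
  by_cases hp : p = j ∧ s' = s
  · obtain ⟨rfl, rfl⟩ := hp
    have h1 : ∀ b, (spiralMult n c d b (2 * p + s'.toNat) : ℤ) =
        spiralMult n c d b (2 * p + s'.toNat + 1) +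
          if b ≤ c + 2 * n * d then 1 else 0 := fun b => by
      rw [← hj, spiralMult_line hc]
      push_cast
      rfl
    -- The α-arc ends on row line `c + 2 * n * d`. Turn 1 counted from outside has d turns within
    -- it, so this end is the new component of y.
    have h3 : (k = 1 ∧ q = p ∧ t' = !s') ↔
        2 * level k q + (!t').toNat = c + 2 * n * d := by
      have h4 : level (1 : Fin (d + 2)) p = p + n * d := by
        simp [level]
        ring
      constructor
      · rintro ⟨rfl, rfl, rfl⟩
        rw [h4, hj, Bool.not_not]
        ring
      · intro h
        have h5 : level k q = level (1 : Fin (d + 2)) p ∧ t' = !s' := by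
          rw [h4]
          rw [mul_assoc] at h
          generalize n * d = N at *
          cases t' <;> cases s' <;> simp at h hj ⊢ <;> omega
        exact ⟨(level_inj h5.1).1, (level_inj h5.1).2, h5.2⟩
    simp only [true_and, h3]
    generalize c + 2 * n * d = E at *
    have h2 := h1 (2 * level k q + (!t').toNat)
    have h2' := h1 (2 * level k q + (!t').toNat + 1)
    -- The jump across the α-arc differs between consecutive rows only at the end of the arc.
    have h6 : ((if 2 * level k q + (!t').toNat ≤ E then 1 else 0) : ℤ) =
        (if 2 * level k q + (!t').toNat + 1 ≤ E then 1 else 0) +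
          if 2 * level k q + (!t').toNat = E then 1 else 0 := by
      split_ifs <;> omega
    cases s' <;> cases t' <;> simp [sideCell] at * <;> linarith
  · have h1 : 2 * (p : ℕ) + s'.toNat ≠ c := by
      rintro rfl
      apply hp
      have := Bool.toNat_lt s
      have := Bool.toNat_lt s'
      refine ⟨Fin.ext (by omega), ?_⟩
      cases s <;> cases s' <;> simp at hj ⊢ <;> omega
    have h2 := fun b => spiralMult_succ_of_ne (n := n) (d := d) b h1
    rw [if_neg (fun h => hp ⟨h.2.1, h.2.2.2.1⟩)]
    cases s' <;> cases t' <;> simp [sideCell] at * <;> simp [h2]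

/-- The boundary of the spiral along the `α`-curves, at the end of a strand. -/
theorem cornerMult_boundary_zEnd (hs : Function.Injective D.strand) (hc : c < 2 * n) {j : Fin n}
    {s : Bool} (hj : c = 2 * j + s.toNat) (p : Fin n) (s' : Bool) :
    (D.cornerMult c d (zEnd (D.strand p) s', true, !s') -
        D.cornerMult c d (zEnd (D.strand p) s', false, !s')) -
      (D.cornerMult c d (zEnd (D.strand p) s', true, s') -
        D.cornerMult c d (zEnd (D.strand p) s', false, s')) =
    if p = j ∧ s' = s then 1 else 0 := by
  simp only [cornerMult_zEnd hs hc]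
  by_cases hp : p = j ∧ s' = s
  · obtain ⟨rfl, rfl⟩ := hp
    have h1 : (spiralMult n c d 0 (2 * p + s'.toNat) : ℤ) =
        spiralMult n c d 0 (2 * p + s'.toNat + 1) + 1 := by
      rw [← hj, spiralMult_line hc]
      simp
    cases s' <;> simp [sideCell] at * <;> linarith
  · have h1 : 2 * (p : ℕ) + s'.toNat ≠ c := by
      rintro rfl
      apply hp
      have := Bool.toNat_lt s
      have := Bool.toNat_lt s'
      refine ⟨Fin.ext (by omega), ?_⟩
      cases s <;> cases s' <;> simp at hj ⊢ <;> omega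
    have h2 := fun b => spiralMult_succ_of_ne (n := n) (d := d) b h1
    rw [if_neg hp]
    cases s' <;> simp [sideCell] at * <;> simp [h2]

end cornerMult

theorem mem_cases {m : ℕ} (P : BridgePoint T (X ⊕ (Fin m × Fin n × Fin n))) :
    (∃ x s t, P = cross (Sum.inl x) s t) ∨ (∃ k p q s t, P = cross (Sum.inr (k, p, q)) s t) ∨
      (∃ p s, P = zEnd (D.strand p) s) ∨ (∃ i s, i ∉ Set.range D.strand ∧ P = zEnd i s) ∨
      ∃ i s, P = wEnd i s := by
  rcases P with ⟨x | ⟨k, p, q⟩, s, t⟩ | ⟨i, s⟩ | ⟨i, s⟩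
  · exact Or.inl ⟨x, s, t, rfl⟩
  · exact Or.inr (Or.inl ⟨k, p, q, s, t, rfl⟩)
  · by_cases h : i ∈ Set.range D.strand
    · obtain ⟨p, rfl⟩ := h
      exact Or.inr (Or.inr (Or.inl ⟨p, s, rfl⟩))
    · exact Or.inr (Or.inr (Or.inr (Or.inl ⟨i, s, h, rfl⟩)))
  · exact Or.inr (Or.inr (Or.inr (Or.inr ⟨i, s, rfl⟩)))

theorem line_ne {c : ℕ} {j p : Fin n} {s : Bool} (hj : c = 2 * j + s.toNat) (h : p ≠ j)
    (s' : Bool) : 2 * (p : ℕ) + s'.toNat ≠ c := by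
  intro h'
  have := Bool.toNat_lt s
  have := Bool.toNat_lt s'
  exact h (Fin.ext (by omega))

theorem cornerMult_zEnd_eq (hs : Function.Injective D.strand) {c d : ℕ} (hc : c < 2 * n)
    {j p : Fin n} {s : Bool} (hj : c = 2 * j + s.toNat) (h : p ≠ j) (s' e f : Bool) :
    D.cornerMult c d (zEnd (D.strand p) s', e, f) = spiralMult n c d 0 (2 * p) := by
  rw [cornerMult_zEnd hs hc]
  have h1 := spiralMult_succ_of_ne (n := n) (d := d) 0 (line_ne hj h false)
  have h2 := spiralMult_succ_of_ne (n := n) (d := d) 0 (line_ne hj h true)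
  cases s' <;> cases e <;> cases f <;> simp [sideCell] at * <;> simp [h1, h2]

theorem cornerMult_alpha_eq (hs : Function.Injective D.strand) {c d : ℕ} (hc : c < 2 * n)
    {j : Fin n} {s : Bool} (hj : c = 2 * j + s.toNat) {i : Fin (T + 1)} (hi : D.strand j ≠ i)
    {P : BridgePoint T (X ⊕ (Fin (d + 2) × Fin n × Fin n))} (hP : P ∈ (D.heegaard (d + 2)).α i)
    (f : Bool) : D.cornerMult c d (P, true, f) = D.cornerMult c d (P, false, f) := by
  rcases mem_cases (D := D) P with ⟨x, s', t', rfl⟩ | ⟨k, p, q, s', t', rfl⟩ | ⟨p, s', rfl⟩ |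
    ⟨i, s', h, rfl⟩ | ⟨i, s', rfl⟩
  · rfl
  · have hp : p ≠ j := by
      rintro rfl
      exact hi (strand_eq_of_mem_alpha hP)
    have h2 := fun b => spiralMult_succ_of_ne (n := n) (d := d) b (line_ne hj hp s')
    rw [cornerMult_cross_inr hc, cornerMult_cross_inr hc]
    cases s' <;> simp [sideCell] at * <;> simp [h2]
  · have hp : p ≠ j := by
      rintro rfl
      exact hi (eq_of_zEnd_mem_alpha hP)
    rw [cornerMult_zEnd_eq hs hc hj hp, cornerMult_zEnd_eq hs hc hj hp]
  · rw [cornerMult_zEnd_of_notMem h, cornerMult_zEnd_of_notMem h]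
  · rfl

theorem cornerMult_beta_eq (hs : Function.Injective D.strand) {c d : ℕ} (hc : c < 2 * n)
    {j : Fin n} {s : Bool} (hj : c = 2 * j + s.toNat) {i : Fin (T + 1)} (hi : D.strand j ≠ i)
    {P : BridgePoint T (X ⊕ (Fin (d + 2) × Fin n × Fin n))} (hP : P ∈ (D.heegaard (d + 2)).β i)
    (e : Bool) : D.cornerMult c d (P, e, true) = D.cornerMult c d (P, e, false) := by
  rcases mem_cases (D := D) P with ⟨x, s', t', rfl⟩ | ⟨k, p, q, s', t', rfl⟩ | ⟨p, s', rfl⟩ |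
    ⟨i, s', h, rfl⟩ | ⟨i, s', rfl⟩
  · rfl
  · have hp : q ≠ j := by
      rintro rfl
      exact hi (strand_eq_of_mem_beta hP)
    have h2 : ∀ a, _ := fun a => spiralMult_succ_left (n := n) (d := d)
      (b := 2 * level k q + (!t').toNat) (a := a) hc (by rw [line_mod]; exact line_ne hj hp _)
    rw [cornerMult_cross_inr hc, cornerMult_cross_inr hc]
    cases t' <;> simp [sideCell] at * <;> simp [h2]
  · have hp : p ≠ j := by
      rintro rfl
      exact hi (eq_of_zEnd_mem_beta hP)
    rw [cornerMult_zEnd_eq hs hc hj hp, cornerMult_zEnd_eq hs hc hj hp]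
  · rw [cornerMult_zEnd_of_notMem h, cornerMult_zEnd_of_notMem h]
  · rfl

/-- The domain of the spiral, which connects a state with a component `zEnd (D.strand j) s` to the
state where this component is pushed `d` turns outwards. -/
noncomputable def spiralDomain (hs : Function.Injective D.strand) {c d : ℕ} (hc : c < 2 * n)
    {j : Fin n} {s : Bool} (hj : c = 2 * j + s.toNat) {l : Fin T} (hl : D.strand j = l.succ)
    (x y : (D.heegaard (d + 2)).State) (hx : x.1 l = zEnd (D.strand j) s)
    (hy : y.1 = Function.update x.1 l (cross (Sum.inr (1, j, j)) s (!s))) :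
    (D.heegaard (d + 2)).Domain x y where
  -- The winding-number chain itself leads from `y` to `x`; the sign reverses it.
  mult f := -(cellMult n c d (faceCell hs (Nat.succ_pos _) f) : ℤ)
  boundary P := by
    classical
    obtain ⟨σ, hσ⟩ := x.2
    rw [HeegaardDiagram.State.ind_sub_ind hy, hx]
    · change (-D.cornerMult c d _ - -D.cornerMult c d _) -
        (-D.cornerMult c d _ - -D.cornerMult c d _) = _
      rcases mem_cases (D := D) P with ⟨x, s', t', rfl⟩ | ⟨k, p, q, s', t', rfl⟩ | ⟨p, s', rfl⟩ |
        ⟨i, s', h, rfl⟩ | ⟨i, s', rfl⟩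
      · simp [cornerMult_cross_inl]
      · have := cornerMult_boundary_cross (D := D) (d := d) hc hj k p q s' t'
        have hpos : (D.heegaard (d + 2)).pos (cross (Sum.inr (k, p, q)) s' t') = (s' == t') := by
          simp [StrandDiagram.heegaard, BridgeDiagram.heegaard, twist]
        rw [hpos]
        simp only [cross.injEq, Sum.inr.injEq, Prod.mk.injEq, reduceCtorEq, if_false, and_assoc]
        linarith
      · have := cornerMult_boundary_zEnd (D := D) (d := d) hs hc hj p s'
        have hpos : (D.heegaard (d + 2)).pos (zEnd (D.strand p) s') = !s' := rfl
        rw [hpos, Bool.not_not]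
        simp only [zEnd.injEq, reduceCtorEq, if_false, hs.eq_iff]
        linarith
      · simp only [cornerMult_zEnd_of_notMem h, zEnd.injEq, reduceCtorEq, if_false]
        rw [if_neg]
        · simp
        · rintro ⟨rfl, -⟩
          exact h ⟨j, rfl⟩
      · simp [cornerMult_wEnd]
    · intro l' h h'
      have := (hσ l').1
      rw [h', hx] at this
      have := eq_of_zEnd_mem_alpha this
      rw [hl] at this
      exact h (Fin.succ_injective _ this).symm
    · intro l' h h'
      have := (hσ l').1
      rw [h'] at this
      have := strand_eq_of_mem_alpha this
      rw [hl] at this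
      exact h (Fin.succ_injective _ this).symm
  not_alpha_zero P hP f := congrArg Neg.neg
    (cornerMult_alpha_eq hs hc hj (by rw [hl]; exact Fin.succ_ne_zero l) hP f)
  not_beta_zero P hP e := congrArg Neg.neg
    (cornerMult_beta_eq hs hc hj (by rw [hl]; exact Fin.succ_ne_zero l) hP e)

/-! ### The Maslov index of the spiral. -/

section spiralDomain

variable {hs : Function.Injective D.strand} {c d : ℕ} {hc : c < 2 * n} {j : Fin n} {s : Bool}
  {hj : c = 2 * j + s.toNat} {l : Fin T} {hl : D.strand j = l.succ}
  {x y : (D.heegaard (d + 2)).State} {hx : x.1 l = zEnd (D.strand j) s}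
  {hy : y.1 = Function.update x.1 l (cross (Sum.inr (1, j, j)) s (!s))}

theorem spiralDomain_mult (P : Corner (BridgePoint T (X ⊕ (Fin (d + 2) × Fin n × Fin n)))) :
    (spiralDomain hs hc hj hl x y hx hy).mult ((D.heegaard (d + 2)).face P) =
      -D.cornerMult c d P := rfl

/-- All corners at the ends w have cell `none`, where the multiplicity is zero by definition. -/
theorem spiralDomain_nw : (spiralDomain hs hc hj hl x y hx hy).nw = 0 :=
  Finset.sum_eq_zero fun _ _ => rfl

theorem spiralDomain_pointMeasure_nonpos
    (P : BridgePoint T (X ⊕ (Fin (d + 2) × Fin n × Fin n))) :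
    (spiralDomain hs hc hj hl x y hx hy).pointMeasure P ≤ 0 := by
  refine div_nonpos_of_nonpos_of_nonneg ?_ (by norm_num)
  refine Finset.sum_nonpos fun e _ => Finset.sum_nonpos fun f _ => ?_
  rw [spiralDomain_mult, Int.cast_nonpos, Left.neg_nonpos_iff]
  exact Int.natCast_nonneg _

theorem spiralDomain_eulerMeasure_le [Fintype X] :
    (spiralDomain hs hc hj hl x y hx hy).eulerMeasure ≤ -d := by
  classical
  have : Finite (D.heegaard (d + 2)).Face := inferInstanceAs (Finite (Quot _))
  have := Fintype.ofFinite (D.heegaard (d + 2)).Face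
  rw [HeegaardDiagram.Domain.eulerMeasure_eq]
  have h := euler_bound (X := X) hc hs (d := d) (faceCell hs (Nat.succ_pos (d + 1)))
    fun P => ⟨(D.heegaard (d + 2)).face P, rfl⟩
  have h1 : ∑ f, ((spiralDomain hs hc hj hl x y hx hy).mult f : ℚ) =
      -∑ f, (cellMult n c d (faceCell hs (Nat.succ_pos (d + 1)) f) : ℚ) := by
    rw [← Finset.sum_neg_distrib]
    refine Finset.sum_congr rfl fun f _ => ?_
    simp [spiralDomain]
  have h2 : ∑ P, ((spiralDomain hs hc hj hl x y hx hy).mult ((D.heegaard (d + 2)).face P) : ℚ) =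
      -∑ P, (cellMult n c d (D.cornerCell (d + 2) P) : ℚ) := by
    rw [← Finset.sum_neg_distrib]
    refine Finset.sum_congr rfl fun P _ => ?_
    simp [spiralDomain_mult, cornerMult]
  rw [h1, h2]
  linarith

theorem spiralDomain_maslovIndex_le [Fintype X] :
    (spiralDomain hs hc hj hl x y hx hy).maslovIndex ≤ -d := by
  have h1 := spiralDomain_eulerMeasure_le (hs := hs) (hc := hc) (hj := hj) (hl := hl) (hx := hx)
    (hy := hy)
  have h2 : ∑ i, (spiralDomain hs hc hj hl x y hx hy).pointMeasure (x.1 i) ≤ 0 :=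
    Finset.sum_nonpos fun i _ => spiralDomain_pointMeasure_nonpos _
  have h3 : ∑ i, (spiralDomain hs hc hj hl x y hx hy).pointMeasure (y.1 i) ≤ 0 :=
    Finset.sum_nonpos fun i _ => spiralDomain_pointMeasure_nonpos _
  unfold HeegaardDiagram.Domain.maslovIndex
  linarith

end spiralDomain

/-- A state with a component among the inner points has a Maslov grading far below that of some
other state. -/
theorem exists_maslov_add_le [Fintype X] (hs : Function.Injective D.strand)
    (hr : ∀ i : Fin (T + 1), (i : ℕ) < n → i ∈ Set.range D.strand) {d : ℕ}
    {M : (D.heegaard (d + 2)).State → ℤ} (hM : (D.heegaard (d + 2)).IsMaslovGrading M)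
    (x : (D.heegaard (d + 2)).State) {l : Fin T} (hx : x.1 l ∈ innerPoints T n _) :
    ∃ y, M x + d ≤ M y := by
  obtain ⟨i, s, -, hi, hxi⟩ := hx
  obtain ⟨j, rfl⟩ := hr i hi
  obtain ⟨σ, hσ⟩ := x.2
  have h1 := hσ l
  rw [hxi] at h1
  -- The inner point lies on just one α- and one β-curve, of equal index, so `σ` fixes `l` and a
  -- crossing of the same two bands can replace it under the same `σ`.
  have hl : D.strand j = l.succ := eq_of_zEnd_mem_alpha h1.1
  have hl' : D.strand j = (σ l).succ := eq_of_zEnd_mem_beta h1.2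
  let y : (D.heegaard (d + 2)).State :=
    ⟨Function.update x.1 l (cross (Sum.inr (1, j, j)) s (!s)), σ, fun l' => by
      by_cases h : l' = l
      · subst h
        rw [Function.update_self]
        refine ⟨?_, ?_⟩
        · rw [← hl]; exact cross_mem_alpha _ _ _ _ _
        · rw [← hl']; exact cross_mem_beta _ _ _ _ _
      · rw [Function.update_of_ne h]
        exact hσ l'⟩
  have hc : 2 * (j : ℕ) + s.toNat < 2 * n := by
    have := Bool.toNat_lt s
    omega
  refine ⟨y, ?_⟩
  have h2 := hM x y (spiralDomain hs hc rfl hl x y hxi rfl)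
  rw [spiralDomain_nw] at h2
  have h3 := spiralDomain_maslovIndex_le (hs := hs) (hc := hc) (hj := rfl) (hl := hl) (x := x)
    (y := y) (hx := hxi) (hy := rfl)
  have h4 : ((M x - M y : ℤ) : ℚ) ≤ ((-d : ℤ) : ℚ) := by
    rw [h2]
    push_cast
    linarith
  have := Int.cast_le.1 h4
  linarith

end StrandDiagram

/-! ### The highest gradings. -/

/-- Variables only lower the grading, so a monomial multiple of `x` in grading `d` forces `d ≤ M x`.
-/
theorem HeegaardDiagram.CFKgr_subset_spanned (F : Type*) [Field F] {T : ℕ} {P : Type}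
    {H : HeegaardDiagram T P} {M : H.State → ℤ} {d : ℤ} {S : Set H.State}
    (h : ∀ x, d ≤ M x → x ∈ S) :
    (H.CFKgr F M d : Set (H.CFK F)) ⊆ (H.spanned F S : Set (H.CFK F)) := by
  have : H.CFKgr F M d ≤ (H.spanned F S).restrictScalars F := by
    refine Submodule.span_le.2 ?_
    rintro _ ⟨x, e, hd, rfl⟩
    have hx : x ∈ S := h x (by have := Int.natCast_nonneg e.degree; linarith)
    have h1 : (Finsupp.single x (MvPolynomial.monomial e 1) : H.CFK F) =
        MvPolynomial.monomial e (1 : F) • Finsupp.single x 1 := by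
      rw [Finsupp.smul_single, smul_eq_mul, mul_one]
    rw [h1]
    exact Submodule.smul_mem (H.spanned F S) _ (Submodule.subset_span ⟨x, hx, rfl⟩)
  exact this

theorem mainTheorem3 (F : Type*) [Field F] {T n : ℕ} {X : Type} [Fintype X] [DecidableEq X]
    (D : StrandDiagram T n X) (hD : D.IsValid) (k : ℕ) :
    ∃ mk : ℕ, ∀ m : ℕ, mk ≤ m →
      ∀ M : (D.heegaard m).State → ℤ, (D.heegaard m).IsMaslovGrading M →
        ∀ B : ℤ, IsGreatest (Set.range M) B →
          ∀ j : ℕ, j < k →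
            ((D.heegaard m).CFKgr F M (B - j) : Set ((D.heegaard m).CFK F)) ⊆
              ((D.heegaard m).spanned F (D.family m (n - 1)) : Set ((D.heegaard m).CFK F)) := by
  -- With m = d + 2 the gap d is at least k, which exceeds `j`.
  refine ⟨k + 2, fun m hm M hM B hB j hj => HeegaardDiagram.CFKgr_subset_spanned F fun x hx => ?_⟩
  obtain ⟨d, rfl⟩ : ∃ d, m = d + 2 := ⟨m - 2, by omega⟩
  have h : ∀ l, x.1 l ∉ StrandDiagram.innerPoints T n _ := by
    intro l hl
    obtain ⟨y, hy⟩ := StrandDiagram.exists_maslov_add_le hD.strand_injective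
      (fun i => (hD.range_strand i).2) hM x hl
    have := hB.2 ⟨y, rfl⟩
    omega
  -- Truncated subtraction: `n - 1 + 1 = n` needs n positive.
  have hn := hD.n_pos
  simp only [StrandDiagram.family, Set.mem_ofPred_eq, h, Set.ofPred_false, Set.ncard_empty]
  omega
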